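/- Let $G=(N,E)$ be a finite simple graph. A coalition structure over $N$ is a partition of $N$ into nonempty sets (coalitions); it is connected if each coalition induces a connected subgraph of $G$. A function $v:2^N\to\mathbb{R}$ with $v(\emptyset)=0$ is independent of disconnected members (IDM) if $v(C\cup\{i\})-v(C)=v(C\cup\{i,j\})-v(C\cup\{j\})$ for all $C\subseteq N$ and all distinct $i,j\in N\setminus C$ that are separated by $C$ in the subgraph induced by $C\cup\{i,j\}$, i.e. that are not adjacent. The graph coalition structure generation (GCSG) problem is: given a connected graph $G=(N,E)$ and oracle access to an IDM function $v$, find a coalition structure $\mathcal{C}$ over $N$ that maximises $\sum_{C\in\mathcal{C}}v(C)$. A class $S$ of graphs satisfies an $f(n)$-separator theorem with constant $\alpha<1$ if every $G\in S$ with $n$ vertices has subgraphs $A,B$ with $A\cup B=G$, such that $A\cap B$ has at most $f(n)$ vertices and each of $A\setminus B$ and $B\setminus A$ has at most $\alpha n$ vertices. Algorithms are programs of a first-order recursive language on tree-shaped data, and steps are counted at unit cost: one per evaluation rule, including arithmetic and comparison of natural numbers, addition, subtraction and comparison of real numbers, and a query of $v$. A graph is given by its adjacency lists. Let $S$ be a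 class of finite simple graphs that is closed under isomorphism and under taking subgraphs. Let $\mu:[0,\infty)\to\mathbb{R}$ be nondecreasing with $\mu(n)\le n^2/2$ for every natural number $n$, such that $|E|\le\mu(n)$ for every $G=(N,E)\in S$ with $|N|=n$. Let $f$ be a nondecreasing nonnegative function with $f(n)=o(n)$, and suppose that $S$ satisfies an $f(n)$-separator theorem with constant $\alpha<1$, and that an algorithm finds such subgraphs $A,B$ (their vertex sets) for every $n$-vertex $G\in S$ in $o\bigl(2^{2\mu(f(n))}f(n)^{2f(n)}\bigr)$ steps. Then: 1. every $G\in S$ with $n$ vertices has at most $2^{\mu(n)}$ connected coalition structures; 2. for every $\beta$ with $\max(\alpha,0)<\beta<1$ and $c=1/|\log\beta|$ (natural logarithms), there is an algorithm that solves the GCSG problem for every connected $n$-vertex graph of $S$ and every IDM function $v$ with $v(\emptyset)=0$ in $$O\Bigl(n^{\,2\log(2)\,c\,\mu(f(n))+2c\,f(n)\log(c\log(n)f(n))}\Bigr)$$ steps. -/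

import Mathlib

open Asymptotics Filter

/-! ### Model of computation

A first-order recursive functional language on tree-shaped data, with unit-cost arithmetic on
natural numbers, unit-cost addition, subtraction and comparison of real numbers, and unit-cost
access to an oracle for a set function. Every rule of the evaluation relation counts one step. -/

/-- Data: binary trees whose leaves are natural or real numbers. -/
inductive Val : Type
  | nat (k : ℕ)
  | real (x : ℝ)
  | pair (a b : Val)

namespace Val

/-- A list is a right-nested tuple that ends in the number `0`. -/
def ofList : List Val → Val
  | [] => nat 0
  | a :: l => pair a (ofList l)

/-- A list of natural numbers as a datum. -/
def ofNats (l : List ℕ) : Val := ofList (l.map nat)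

/-- A list of vertices as a datum. -/
def ofVertices {n : ℕ} (l : List (Fin n)) : Val := ofNats (l.map Fin.val)

end Val

/-- The binary primitives: addition, subtraction and comparison. -/
inductive BinOp : Type
  | add
  | sub
  | le

open Classical in
/-- Value of a primitive; it acts on two natural numbers (with truncated subtraction) or on two
real numbers, and is undefined otherwise. A comparison returns the number `1` or `0`. -/
noncomputable def BinOp.app : BinOp → Val → Val → Option Val
  | .add, .nat a, .nat b => some (.nat (a + b))
  | .sub, .nat a, .nat b => some (.nat (a - b))
  | .le, .nat a, .nat b => some (.nat (if a ≤ b then 1 else 0))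
  | .add, .real a, .real b => some (.real (a + b))
  | .sub, .real a, .real b => some (.real (a - b))
  | .le, .real a, .real b => some (.nat (if a ≤ b then 1 else 0))
  | _, _, _ => none

/-- Programs. Data variables and function names are de Bruijn indices. -/
inductive Prog : Type
  /-- a data variable -/
  | var (i : ℕ)
  /-- a natural number constant -/
  | lit (k : ℕ)
  /-- `let x := e in b` -/
  | letIn (e b : Prog)
  | pair (e₁ e₂ : Prog)
  | fst (e : Prog)
  | snd (e : Prog)
  | bin (op : BinOp) (e₁ e₂ : Prog)
  /-- conditional; the number `0` (also the empty list) is false, everything else is true -/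
  | ite (c e₁ e₂ : Prog)
  /-- declare a (recursive) function of one argument with the given body, in scope in `e` -/
  | letRec (body e : Prog)
  /-- call the `i`-th function in scope -/
  | call (i : ℕ) (e : Prog)
  /-- ask the oracle for the value of the set listed by `e` -/
  | query (e : Prog)

/-- An oracle: a partial real function of finite sets of natural numbers. A query at which it is
undefined gets stuck. -/
abbrev Oracle := Finset ℕ → Option ℝ

/-- The absent oracle. -/
def noOracle : Oracle := fun _ => none

/-- `Eval O Γ ρ e y t`: with oracle `O`, functions `Γ` in scope and data variables `ρ`, the program
`e` halts with result `y` after exactly `t` steps. A function body sees its argument as its only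
data variable, itself as function `0`, and the functions in scope at its declaration. -/
inductive Eval (O : Oracle) : List Prog → List Val → Prog → Val → ℕ → Prop
  | var {Γ ρ i y} : ρ[i]? = some y → Eval O Γ ρ (.var i) y 1
  | lit {Γ ρ k} : Eval O Γ ρ (.lit k) (.nat k) 1
  | letIn {Γ ρ e b x y s t} : Eval O Γ ρ e x s → Eval O Γ (x :: ρ) b y t →
      Eval O Γ ρ (.letIn e b) y (s + t + 1)
  | pair {Γ ρ e₁ e₂ x y s t} : Eval O Γ ρ e₁ x s → Eval O Γ ρ e₂ y t →
      Eval O Γ ρ (.pair e₁ e₂) (.pair x y) (s + t + 1)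
  | fst {Γ ρ e x y t} : Eval O Γ ρ e (.pair x y) t → Eval O Γ ρ (.fst e) x (t + 1)
  | snd {Γ ρ e x y t} : Eval O Γ ρ e (.pair x y) t → Eval O Γ ρ (.snd e) y (t + 1)
  | bin {Γ ρ op e₁ e₂ x y z s t} : Eval O Γ ρ e₁ x s → Eval O Γ ρ e₂ y t →
      op.app x y = some z → Eval O Γ ρ (.bin op e₁ e₂) z (s + t + 1)
  | iteTrue {Γ ρ c e₁ e₂ x y s t} : Eval O Γ ρ c x s → x ≠ .nat 0 → Eval O Γ ρ e₁ y t →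
      Eval O Γ ρ (.ite c e₁ e₂) y (s + t + 1)
  | iteFalse {Γ ρ c e₁ e₂ y s t} : Eval O Γ ρ c (.nat 0) s → Eval O Γ ρ e₂ y t →
      Eval O Γ ρ (.ite c e₁ e₂) y (s + t + 1)
  | letRec {Γ ρ body e y t} : Eval O (body :: Γ) ρ e y t →
      Eval O Γ ρ (.letRec body e) y (t + 1)
  | call {Γ Γ' ρ i body e x y s t} : Eval O Γ ρ e x s → Γ.drop i = body :: Γ' →
      Eval O (body :: Γ') [x] body y t → Eval O Γ ρ (.call i e) y (s + t + 1)
  | query {Γ ρ e l r t} : Eval O Γ ρ e (Val.ofNats l) t → O l.toFinset = some r →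
      Eval O Γ ρ (.query e) (.real r) (t + 1)

/-- The program `p`, with oracle `O`, halts on input `x` with output `y` after exactly `t` steps. -/
def Runs (O : Oracle) (p : Prog) (x y : Val) (t : ℕ) : Prop := Eval O [] [x] p y t

/-! ### Graphs, separators and coalition structures -/

open Classical in
/-- A graph as input: the list of the adjacency lists of its vertices. -/
noncomputable def encodeGraph {n : ℕ} (G : SimpleGraph (Fin n)) : Val :=
  Val.ofList ((List.finRange n).map fun i =>
    Val.ofVertices ((List.finRange n).filter fun j => G.Adj i j))

/-- A class of finite graphs, given by its members on the vertex sets `Fin n`. -/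
abbrev GraphClass := (n : ℕ) → Set (SimpleGraph (Fin n))

/-- The class is closed under taking subgraphs (and hence under isomorphism): with `G` it contains
every graph that has an injective homomorphism to `G`. -/
def GraphClass.SubgraphClosed (S : GraphClass) : Prop :=
  ∀ (m n : ℕ) (H : SimpleGraph (Fin m)) (G : SimpleGraph (Fin n)),
    G ∈ S n → H.IsContained G → H ∈ S m

/-- The subgraphs `A`, `B` cover `G`, share at most `k` vertices, and each has at most `α n` vertices
outside the other. -/
def IsSeparation {n : ℕ} (G : SimpleGraph (Fin n)) (α k : ℝ) (A B : G.Subgraph) : Prop :=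
  A ⊔ B = ⊤ ∧ ((A.verts ∩ B.verts).ncard : ℝ) ≤ k ∧
    ((A.verts \ B.verts).ncard : ℝ) ≤ α * n ∧ ((B.verts \ A.verts).ncard : ℝ) ≤ α * n

/-- The class satisfies an `f(n)`-separator theorem with constant `α`. -/
def GraphClass.SeparatorTheorem (S : GraphClass) (f : ℕ → ℝ) (α : ℝ) : Prop :=
  ∀ (n : ℕ), ∀ G ∈ S n, ∃ A B : G.Subgraph, IsSeparation G α (f n) A B

/-- The program `p`, without any oracle, finds on every `n`-vertex graph of the class such a
separation in at most `s n` steps. The output lists the vertices of the two subgraphs. -/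
def GraphClass.FindsSeparators (S : GraphClass) (f : ℕ → ℝ) (α : ℝ) (p : Prog) (s : ℕ → ℝ) : Prop :=
  ∀ (n : ℕ), ∀ G ∈ S n, ∃ (a b : List (Fin n)) (t : ℕ),
    Runs noOracle p (encodeGraph G) (.pair (.ofVertices a) (.ofVertices b)) t ∧ (t : ℝ) ≤ s n ∧
    ∃ A B : G.Subgraph, IsSeparation G α (f n) A B ∧ A.verts = {i | i ∈ a} ∧ B.verts = {i | i ∈ b}

/-- A coalition structure is a partition of the vertex set. -/
abbrev CoalitionStructure (n : ℕ) := Finpartition (Finset.univ : Finset (Fin n))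

/-- All coalitions induce connected subgraphs. -/
def CoalitionStructure.IsConnected {n : ℕ} (G : SimpleGraph (Fin n)) (P : CoalitionStructure n) :
    Prop :=
  ∀ C ∈ P.parts, (G.induce (C : Set (Fin n))).Connected

/-- The sum of the values of the coalitions. -/
def CoalitionStructure.value {n : ℕ} (v : Finset (Fin n) → ℝ) (P : CoalitionStructure n) : ℝ :=
  ∑ C ∈ P.parts, v C

/-- The valuation is independent of disconnected members: the marginal contributions of `i` and `j`
to `C` are independent whenever `C` separates `i` from `j` in the subgraph induced by
`C ∪ {i, j}`, that is, whenever `i` and `j` lie outside `C` and are distinct and not adjacent. -/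
def IsIDM {n : ℕ} (G : SimpleGraph (Fin n)) (v : Finset (Fin n) → ℝ) : Prop :=
  ∀ (C : Finset (Fin n)) (i j : Fin n), i ∉ C → j ∉ C → i ≠ j → ¬ G.Adj i j →
    v (C ∪ {i}) - v C = v (C ∪ {i, j}) - v (C ∪ {j})

/-- The oracle that returns the value of a coalition. -/
def valuationOracle {n : ℕ} (v : Finset (Fin n) → ℝ) : Oracle :=
  fun s => some (v (Finset.univ.filter fun i => i.val ∈ s))

/-- The datum `y` lists the coalitions of `P`, each exactly once and as a list of its members. -/
def ListsCoalitions {n : ℕ} (y : Val) (P : CoalitionStructure n) : Prop :=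
  ∃ L : List (List (Fin n)), y = Val.ofList (L.map Val.ofVertices) ∧
    (L.map List.toFinset : Multiset (Finset (Fin n))) = P.parts.val

/-- The program `p` solves the graph coalition structure generation problem on the connected graphs
of the class: from the graph and an oracle for an arbitrary valuation `v` that is independent of
disconnected members, it finds a coalition structure of maximum value, in at most `T n` steps on
`n`-vertex graphs. -/
def GraphClass.SolvesGCSG (S : GraphClass) (p : Prog) (T : ℕ → ℝ) : Prop :=
  ∀ (n : ℕ), ∀ G ∈ S n, G.Connected →
    ∀ v : Finset (Fin n) → ℝ, v ∅ = 0 → IsIDM G v →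
      ∃ (y : Val) (t : ℕ) (P : CoalitionStructure n),
        Runs (valuationOracle v) p (encodeGraph G) y t ∧ (t : ℝ) ≤ T n ∧
        ListsCoalitions y P ∧ ∀ Q : CoalitionStructure n, Q.value v ≤ P.value v

/-! A connected coalition structure is determined by the edges of `G` that lie inside its
coalitions, since the coalitions are the components of this edge set. There are at most `2 ^ |E|`
edge sets, which gives the count (`ncard_connected_le`).

For the algorithm, a coalition structure is viewed as a colouring of the vertices, valued by the sum
of `v` over its colour classes. Adding vertices one at a time, the IDM identity yields `v (S₀ ∪ S₁ ∪
S₂) + v S₀ = v (S₀ ∪ S₁) + v (S₀ ∪ S₂)` whenever `S₁` and `S₂` are disjoint with no edges between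
them (`IsIDM.union_add`), and the same holds for values of colourings. Hence, once the colouring of
a set containing a separator is fixed, the two sides can be optimised independently
(`IsIDM.isOptimal`).

The algorithm keeps a list `W` of uncoloured vertices and a colouring `σ` of the vertices of all
earlier separators. It separates the subgraph induced by `W`, runs through all partitions of the
separator relative to `σ`, solves both sides recursively for each, and keeps the best result
(`exists_evalIn_solveBody`). A vertex receives either an existing colour or its own name as a new
colour, so every partition occurs.

The sides shrink by the factor `β`, so `D = ⌊c log n⌋ + 1` levels suffice (`pow_floor_mul_lt_one`).
Each level colours at most `F = ⌊f n⌋` vertices, so at most `F * D` are ever coloured, a separator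
has at most `(F * D) ^ F` extensions, and each causes two recursive calls. With `Z` the sum of
`1000`, `2 * n` and the separator time, the total is at most `Z ^ 8 * (4 * (F * D) ^ F) ^ D`. The
logarithm of the second factor is about `c log n * f n * log (c log n * f n)`, half of the
corresponding term of the target exponent; the slack and the `μ` term absorb the rest
(`separator_step_bound`, `isBigO_steps`). -/

/-! ### Evaluation within a time bound -/

/-- Evaluation within at most `T` steps. -/
def EvalIn (O : Oracle) (Γ : List Prog) (ρ : List Val) (e : Prog) (y : Val) (T : ℕ) : Prop :=
  ∃ t ≤ T, Eval O Γ ρ e y t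

/-- Evaluation persists when the oracle is extended and functions and variables are added. -/
theorem Eval.weaken {O O' : Oracle} (hO : ∀ s r, O s = some r → O' s = some r)
    {Γ ρ e y t} (h : Eval O Γ ρ e y t) (Γ₂ : List Prog) (ρ₂ : List Val) :
    Eval O' (Γ ++ Γ₂) (ρ ++ ρ₂) e y t := by
  induction h generalizing ρ₂ with
  | var h =>
    refine .var ?_
    rw [List.getElem?_append_left]
    · exact h
    · exact (List.getElem?_eq_some_iff.1 h).1
  | lit => exact .lit
  | letIn _ _ h₁ h₂ => exact .letIn (h₁ ρ₂) (h₂ ρ₂)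
  | pair _ _ h₁ h₂ => exact .pair (h₁ ρ₂) (h₂ ρ₂)
  | fst _ h => exact .fst (h ρ₂)
  | snd _ h => exact .snd (h ρ₂)
  | bin _ _ hz h₁ h₂ => exact .bin (h₁ ρ₂) (h₂ ρ₂) hz
  | iteTrue _ hx _ h₁ h₂ => exact .iteTrue (h₁ ρ₂) hx (h₂ ρ₂)
  | iteFalse _ _ h₁ h₂ => exact .iteFalse (h₁ ρ₂) (h₂ ρ₂)
  | letRec _ h => exact .letRec (h ρ₂)
  | @call Γ Γ' ρ i body e x y s t _ hd _ h₁ h₂ =>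
    -- A function body sees only its argument, so the induction hypothesis for it is used without
    -- extra variables. Functions appended at the far end of the scope do not disturb the index `i`.
    refine .call (Γ' := Γ' ++ Γ₂) (body := body) (h₁ ρ₂) ?_ (by simpa using h₂ [])
    have hi : i ≤ Γ.length := by
      by_contra hi
      rw [List.drop_eq_nil_of_le (by omega)] at hd
      cases hd
    rw [List.drop_append_of_le_length hi, hd]
    rfl
  | query _ hr h => exact .query (h ρ₂) (hO _ _ hr)

namespace EvalIn

variable {O : Oracle} {Γ : List Prog} {ρ : List Val}

theorem mono {e y T T'} (h : EvalIn O Γ ρ e y T) (hT : T ≤ T') : EvalIn O Γ ρ e y T' :=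
  let ⟨t, ht, h⟩ := h
  ⟨t, ht.trans hT, h⟩

theorem congr {e y y' T} (h : EvalIn O Γ ρ e y T) (hy : y = y') : EvalIn O Γ ρ e y' T := hy ▸ h

theorem weaken {e y T} (h : EvalIn O Γ ρ e y T) (Γ₂ : List Prog) (ρ₂ : List Val) :
    EvalIn O (Γ ++ Γ₂) (ρ ++ ρ₂) e y T :=
  let ⟨t, ht, h⟩ := h
  ⟨t, ht, h.weaken (fun _ _ h => h) Γ₂ ρ₂⟩

theorem weaken_funs {e y T} (h : EvalIn O [] ρ e y T) (Γ₂ : List Prog) :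
    EvalIn O Γ₂ ρ e y T := by
  simpa using h.weaken Γ₂ []

theorem var {i y} (h : ρ[i]? = some y) : EvalIn O Γ ρ (.var i) y 1 := ⟨1, le_rfl, .var h⟩

theorem lit {k} : EvalIn O Γ ρ (.lit k) (.nat k) 1 := ⟨1, le_rfl, .lit⟩

theorem letIn {e b x y s t} (h₁ : EvalIn O Γ ρ e x s) (h₂ : EvalIn O Γ (x :: ρ) b y t) :
    EvalIn O Γ ρ (.letIn e b) y (s + t + 1) :=
  let ⟨_, ha, h₁⟩ := h₁
  let ⟨_, hb, h₂⟩ := h₂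
  ⟨_, by omega, .letIn h₁ h₂⟩

theorem pair {e₁ e₂ x y s t} (h₁ : EvalIn O Γ ρ e₁ x s) (h₂ : EvalIn O Γ ρ e₂ y t) :
    EvalIn O Γ ρ (.pair e₁ e₂) (.pair x y) (s + t + 1) :=
  let ⟨_, ha, h₁⟩ := h₁
  let ⟨_, hb, h₂⟩ := h₂
  ⟨_, by omega, .pair h₁ h₂⟩

theorem fst {e x y t} (h : EvalIn O Γ ρ e (.pair x y) t) : EvalIn O Γ ρ (.fst e) x (t + 1) :=
  let ⟨_, ha, h⟩ := h
  ⟨_, by omega, .fst h⟩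

theorem snd {e x y t} (h : EvalIn O Γ ρ e (.pair x y) t) : EvalIn O Γ ρ (.snd e) y (t + 1) :=
  let ⟨_, ha, h⟩ := h
  ⟨_, by omega, .snd h⟩

theorem bin {op e₁ e₂ x y z s t} (h₁ : EvalIn O Γ ρ e₁ x s) (h₂ : EvalIn O Γ ρ e₂ y t)
    (hz : op.app x y = some z) : EvalIn O Γ ρ (.bin op e₁ e₂) z (s + t + 1) :=
  let ⟨_, ha, h₁⟩ := h₁
  let ⟨_, hb, h₂⟩ := h₂
  ⟨_, by omega, .bin h₁ h₂ hz⟩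

theorem iteTrue {c e₁ e₂ x y s t} (h₁ : EvalIn O Γ ρ c x s) (hx : x ≠ .nat 0)
    (h₂ : EvalIn O Γ ρ e₁ y t) : EvalIn O Γ ρ (.ite c e₁ e₂) y (s + t + 1) :=
  let ⟨_, ha, h₁⟩ := h₁
  let ⟨_, hb, h₂⟩ := h₂
  ⟨_, by omega, .iteTrue h₁ hx h₂⟩

theorem iteFalse {c e₁ e₂ y s t} (h₁ : EvalIn O Γ ρ c (.nat 0) s)
    (h₂ : EvalIn O Γ ρ e₂ y t) : EvalIn O Γ ρ (.ite c e₁ e₂) y (s + t + 1) :=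
  let ⟨_, ha, h₁⟩ := h₁
  let ⟨_, hb, h₂⟩ := h₂
  ⟨_, by omega, .iteFalse h₁ h₂⟩

/-- A conditional whose condition evaluates to a truth value. -/
theorem ite_prop {c e₁ e₂ y₁ y₂ s t} {p : Prop} [Decidable p]
    (h : EvalIn O Γ ρ c (.nat (if p then 1 else 0)) s)
    (h₁ : p → EvalIn O Γ ρ e₁ y₁ t) (h₂ : ¬ p → EvalIn O Γ ρ e₂ y₂ t) :
    EvalIn O Γ ρ (.ite c e₁ e₂) (if p then y₁ else y₂) (s + t + 1) := by
  by_cases hp : p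
  · simp only [hp, if_true] at h ⊢
    exact iteTrue h (by simp) (h₁ hp)
  · simp only [hp, if_false] at h ⊢
    exact iteFalse h (h₂ hp)

theorem letRec {body e y t} (h : EvalIn O (body :: Γ) ρ e y t) :
    EvalIn O Γ ρ (.letRec body e) y (t + 1) :=
  let ⟨_, ha, h⟩ := h
  ⟨_, by omega, .letRec h⟩

theorem call {Γ' i body e x y s t} (h₁ : EvalIn O Γ ρ e x s) (hd : Γ.drop i = body :: Γ')
    (h₂ : EvalIn O (body :: Γ') [x] body y t) : EvalIn O Γ ρ (.call i e) y (s + t + 1) :=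
  let ⟨_, ha, h₁⟩ := h₁
  let ⟨_, hb, h₂⟩ := h₂
  ⟨_, by omega, .call h₁ hd h₂⟩

theorem query {e l r t} (h : EvalIn O Γ ρ e (Val.ofNats l) t) (hr : O l.toFinset = some r) :
    EvalIn O Γ ρ (.query e) (.real r) (t + 1) :=
  let ⟨_, ha, h⟩ := h
  ⟨_, by omega, .query h hr⟩

/-- A closed program used as a function. -/
theorem app {e h x y s t} (h₁ : EvalIn O Γ ρ e x s) (h₂ : EvalIn O [] [x] h y t) :
    EvalIn O Γ ρ (.letIn e h) y (s + t + 1) :=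
  letIn h₁ (h₂.weaken Γ ρ)

end EvalIn

namespace Prog

/-- The value of a program built from variables, constants, pairs and projections. -/
def path (ρ : List Val) : Prog → Option Val
  | var i => ρ[i]?
  | lit k => some (.nat k)
  | pair a b => match path ρ a, path ρ b with
    | some x, some y => some (.pair x y)
    | _, _ => none
  | fst a => match path ρ a with
    | some (.pair x _) => some x
    | _ => none
  | snd a => match path ρ a with
    | some (.pair _ y) => some y
    | _ => none
  | _ => none

/-- The number of nodes of a program built from variables, constants, pairs and projections. -/
def pathSize : Prog → ℕ
  | pair a b => pathSize a + pathSize b + 1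
  | fst a => pathSize a + 1
  | snd a => pathSize a + 1
  | _ => 1

end Prog

theorem EvalIn.of_path_size {O : Oracle} {Γ : List Prog} {ρ : List Val} :
    ∀ {e : Prog} {y : Val}, e.path ρ = some y → EvalIn O Γ ρ e y e.pathSize
  | .var _, _, h => EvalIn.var h
  | .lit _, _, h => by cases h; exact EvalIn.lit
  | .pair a b, y, h => by
    rw [Prog.path] at h
    split at h
    · rename_i ha hb
      cases h
      exact EvalIn.pair (of_path_size ha) (of_path_size hb)
    · cases h
  | .fst a, y, h => by
    rw [Prog.path] at h
    split at h
    · rename_i ha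
      cases h
      exact EvalIn.fst (of_path_size ha)
    · cases h
  | .snd a, y, h => by
    rw [Prog.path] at h
    split at h
    · rename_i ha
      cases h
      exact EvalIn.snd (of_path_size ha)
    · cases h
  | .letIn _ _, _, h => by cases h
  | .bin _ _ _, _, h => by cases h
  | .ite _ _ _, _, h => by cases h
  | .letRec _ _, _, h => by cases h
  | .call _ _, _, h => by cases h
  | .query _, _, h => by cases h

/-- Such expressions are evaluated by computation, so `rfl` supplies the value; the flat cost `20`
makes later step counts independent of their shape. -/
theorem EvalIn.of_path {O : Oracle} {Γ : List Prog} {ρ : List Val} {e : Prog} {y : Val}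
    (h : e.path ρ = some y) (hs : e.pathSize ≤ 20 := by decide) : EvalIn O Γ ρ e y 20 :=
  (EvalIn.of_path_size h).mono hs

/-! ### The length of the output -/

/-- The largest length of a right spine in a datum. -/
def Val.spine : Val → ℕ
  | nat _ => 0
  | real _ => 0
  | pair a b => max a.spine (b.spine + 1)

/-- Only forming a pair can lengthen a right spine, by one, and this costs a step. The separator
program may list vertices repeatedly, so its running time is what bounds the length of its output.
-/
theorem Eval.spine_le {O Γ ρ e y t} (h : Eval O Γ ρ e y t) :
    ∀ H : ℕ, (∀ x ∈ ρ, x.spine ≤ H) → y.spine ≤ H + t := by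
  induction h with
  | var h => intro H hH; exact (hH _ (List.mem_of_getElem? h)).trans (by omega)
  | lit => intro H _; simp [Val.spine]
  | @letIn Γ ρ e b x y s t _ _ h₁ h₂ =>
    intro H hH
    have := h₂ (H + s) (by
      intro z hz
      rcases List.mem_cons.1 hz with rfl | hz
      · exact h₁ H hH
      · exact (hH z hz).trans (by omega))
    omega
  | pair _ _ h₁ h₂ =>
    intro H hH
    have := h₁ H hH
    have := h₂ H hH
    simp only [Val.spine]
    omega
  | fst _ h => intro H hH; have := h H hH; simp only [Val.spine] at this; omega
  | snd _ h => intro H hH; have := h H hH; simp only [Val.spine] at this; omega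
  | @bin Γ ρ op e₁ e₂ x y z s t _ _ hz _ _ =>
    intro H hH
    have : z.spine = 0 := by
      unfold BinOp.app at hz
      split at hz <;> cases hz <;> rfl
    omega
  | iteTrue _ _ _ _ h => intro H hH; have := h H hH; omega
  | iteFalse _ _ _ h => intro H hH; have := h H hH; omega
  | letRec _ h => intro H hH; have := h H hH; omega
  | @call Γ Γ' ρ i body e x y s t _ _ _ h₁ h₂ =>
    intro H hH
    have := h₂ (H + s) (by
      intro z hz
      rw [List.mem_singleton.1 hz]
      exact h₁ H hH)
    omega
  | query _ _ _ => intro H _; simp [Val.spine]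

theorem Val.spine_ofList_le (l : List Val) (H : ℕ) (h : ∀ x ∈ l, x.spine ≤ H) :
    (Val.ofList l).spine ≤ H + l.length := by
  induction l with
  | nil => simp [Val.ofList, Val.spine]
  | cons a l ih =>
    have h₁ := ih fun x hx => h x (List.mem_cons_of_mem _ hx)
    have h₂ := h a List.mem_cons_self
    simp only [Val.ofList, Val.spine, List.length_cons]
    omega

theorem Val.length_le_spine_ofList (l : List Val) : l.length ≤ (Val.ofList l).spine := by
  induction l with
  | nil => simp
  | cons a l ih =>
    simp only [Val.ofList, Val.spine, List.length_cons]
    omega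

theorem Val.ofVertices_eq {n : ℕ} (l : List (Fin n)) :
    Val.ofVertices l = Val.ofList (l.map fun i => .nat i.val) := by
  simp [Val.ofVertices, Val.ofNats, Function.comp_def]

theorem Val.length_le_spine_ofVertices {n : ℕ} (l : List (Fin n)) :
    l.length ≤ (Val.ofVertices l).spine := by
  rw [ofVertices_eq]
  simpa using length_le_spine_ofList (l.map fun i => Val.nat i.val)

theorem spine_encodeGraph_le {n : ℕ} (G : SimpleGraph (Fin n)) :
    (encodeGraph G).spine ≤ 2 * n := by
  refine (Val.spine_ofList_le _ n ?_).trans (by simp; omega)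
  intro x hx
  obtain ⟨i, -, rfl⟩ := List.mem_map.1 hx
  rw [Val.ofVertices_eq]
  refine (Val.spine_ofList_le _ 0 ?_).trans ?_
  · intro x hx
    obtain ⟨i, -, rfl⟩ := List.mem_map.1 hx
    simp [Val.spine]
  · classical simpa using List.length_filter_le (fun j => decide (G.Adj i j)) (List.finRange n)

/-! ### Recursion along a list -/

namespace Prog

/-- The body of a recursive function with argument `(env, l)` that folds the list `l` from the
right. The program `init` sees the variable `env`, the program `step` sees the environment, the
current element and the result for the rest of the list. -/
def foldBody (step init : Prog) : Prog :=
  .ite (.snd (.var 0))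
    (.letIn (.call 0 (.pair (.fst (.var 0)) (.snd (.snd (.var 0)))))
      (.letIn (.fst (.snd (.var 1))) (.letIn (.fst (.var 2)) step)))
    (.letIn (.fst (.var 0)) init)

/-- Fold from the right the list given by `el`, with the environment given by `ee`. -/
def fold (step init ee el : Prog) : Prog :=
  .letRec (foldBody step init) (.call 0 (.pair ee el))

end Prog

/-- Induction on the list, with `R` specifying the result on every suffix. Restricting `hstep` to
suffixes of `l` allows bounds that hold only for members of `l`. The step may call functions of the
surrounding scope, which are shifted by one behind the fold itself. -/
theorem evalIn_foldBody {O : Oracle} {Γ : List Prog} {A : Type*} {enc : A → Val}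
    {R : List A → Val} {step init : Prog} {env : Val} {c ci : ℕ} {l : List A}
    (hinit : EvalIn O [] [env] init (R []) ci)
    (hstep : ∀ a l', (a :: l') <:+ l →
      EvalIn O (Prog.foldBody step init :: Γ) [env, enc a, R l'] step (R (a :: l')) c) :
    EvalIn O (Prog.foldBody step init :: Γ) [.pair env (.ofList (l.map enc))]
      (Prog.foldBody step init) (R l) (l.length * (c + 100) + ci + 60) := by
  induction l with
  | nil =>
    refine EvalIn.mono (EvalIn.iteFalse (EvalIn.of_path rfl (by decide))
      (EvalIn.app (EvalIn.of_path rfl (by decide)) hinit)) ?_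
    simp
    omega
  | cons a l ih =>
    have hs := hstep a l List.suffix_rfl
    have ih := ih fun a l' h => hstep a l' (h.trans (List.suffix_cons _ _))
    refine EvalIn.mono (EvalIn.iteTrue (x := .ofList ((a :: l).map enc))
      (EvalIn.of_path rfl (by decide)) (by simp [Val.ofList])
      (EvalIn.letIn (EvalIn.call (EvalIn.of_path rfl (by decide)) rfl ih)
        (EvalIn.letIn (EvalIn.of_path rfl (by decide))
        (EvalIn.letIn (EvalIn.of_path rfl (by decide)) (by simpa using hs.weaken [] _))))) ?_
    simp only [List.length_cons, Nat.add_mul]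
    omega

theorem evalIn_fold {O : Oracle} {Γ : List Prog} {ρ : List Val} {A : Type*} {enc : A → Val}
    {R : List A → Val} {step init ee el : Prog} {env : Val} {c ci s₁ s₂ : ℕ} {l : List A}
    (hee : EvalIn O [] ρ ee env s₁) (hel : EvalIn O [] ρ el (.ofList (l.map enc)) s₂)
    (hinit : EvalIn O [] [env] init (R []) ci)
    (hstep : ∀ a l', (a :: l') <:+ l →
      EvalIn O (Prog.foldBody step init :: Γ) [env, enc a, R l'] step (R (a :: l')) c) :
    EvalIn O Γ ρ (Prog.fold step init ee el) (R l)
      (s₁ + s₂ + l.length * (c + 100) + ci + 70) := by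
  refine EvalIn.mono (EvalIn.letRec (EvalIn.call
    (EvalIn.pair (hee.weaken_funs _) (hel.weaken_funs _)) rfl
    (evalIn_foldBody hinit hstep))) ?_
  omega

/-! ### Programs for lists -/

namespace Prog

/-- Equality of two natural numbers. -/
def eqNat (e₁ e₂ : Prog) : Prog :=
  .ite (.bin .le e₁ e₂) (.bin .le e₂ e₁) (.lit 0)

/-- Membership of a number in a list; the argument is the pair of both. -/
def mem : Prog :=
  fold (.ite (eqNat (.var 0) (.var 1)) (.lit 1) (.var 2)) (.lit 0) (.fst (.var 0)) (.snd (.var 0))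

/-- The body of the recursive function `nth`. -/
def nthBody : Prog :=
  .ite (.fst (.var 0))
    (.call 0 (.pair (.bin .sub (.fst (.var 0)) (.lit 1)) (.snd (.snd (.var 0)))))
    (.fst (.snd (.var 0)))

/-- The `i`-th element of a list `l`; the argument is `(i, l)`. -/
def nth : Prog := .letRec nthBody (.call 0 (.var 0))

/-- The body of the recursive function `indices`. -/
def indicesBody : Prog :=
  .ite (.snd (.var 0))
    (.pair (.fst (.var 0))
      (.call 0 (.pair (.bin .add (.fst (.var 0)) (.lit 1)) (.snd (.snd (.var 0))))))
    (.lit 0)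

/-- The list of the indices of a list. -/
def indices : Prog := .letRec indicesBody (.call 0 (.pair (.lit 0) (.var 0)))

/-- Concatenation; the argument is the pair of both lists. -/
def append : Prog := fold (.pair (.var 1) (.var 2)) (.var 0) (.snd (.var 0)) (.fst (.var 0))

/-- The list of all indices `j` in `J` such that the `j`-th element of `W` is in `A`; the argument
is `(A, W, J)`. -/
def row : Prog :=
  fold (.ite (.letIn (.pair (.letIn (.pair (.var 1) (.snd (.var 0))) nth) (.fst (.var 0))) mem)
      (.pair (.var 1) (.var 2)) (.var 2)) (.lit 0)
    (.pair (.fst (.var 0)) (.fst (.snd (.var 0)))) (.snd (.snd (.var 0)))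

/-- The subgraph of `G` induced by the list `W` of vertices, with index list `J`; the argument is
`(G, W, J)`. -/
def subgraph : Prog :=
  fold (.pair (.letIn (.pair (.letIn (.pair (.var 1) (.fst (.var 0))) nth) (.snd (.var 0))) row)
      (.var 2)) (.lit 0) (.var 0) (.fst (.snd (.var 0)))

/-- The elements of `W` whose indices `j` in `J` belong to `a` and, depending on `k`, belong or do
not belong to `b`; the argument is `((a, b), W, J)`. -/
def select (k : Bool) : Prog :=
  let keep := Prog.pair (.letIn (.pair (.var 1) (.snd (.var 0))) nth) (.var 2)
  fold (.ite (.letIn (.pair (.var 1) (.fst (.fst (.var 0)))) mem)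
      (.ite (.letIn (.pair (.var 1) (.snd (.fst (.var 0)))) mem)
        (if k then keep else .var 2) (if k then .var 2 else keep)) (.var 2)) (.lit 0)
    (.pair (.fst (.var 0)) (.fst (.snd (.var 0)))) (.snd (.snd (.var 0)))

/-- The keys in an association list `r` with value `c`; the argument is `(c, r)`. -/
def fiber : Prog :=
  fold (.ite (eqNat (.var 0) (.snd (.var 1))) (.pair (.fst (.var 1)) (.var 2)) (.var 2)) (.lit 0)
    (.fst (.var 0)) (.snd (.var 0))

/-- The sum over the colours in `V` of the values of the colour classes of `r`; the argument is
`(V, r)`. -/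
def value : Prog :=
  fold (.bin .add (.query (.letIn (.pair (.var 1) (.var 0)) fiber)) (.var 2)) (.query (.lit 0))
    (.snd (.var 0)) (.fst (.var 0))

/-- The nonempty colour classes of `r`, for the colours in `V`; the argument is `(V, r)`. -/
def classes : Prog :=
  fold (.letIn (.letIn (.pair (.var 1) (.var 0)) fiber)
      (.ite (.var 0) (.pair (.var 0) (.var 3)) (.var 3))) (.lit 0)
    (.snd (.var 0)) (.fst (.var 0))

/-- Prepend to the list `R` all colourings `(x, c) :: ξ`, where `c` is `x` or a colour of the list
`τ`; the argument is `((x, ξ), τ, R)`. -/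
def recolour : Prog :=
  fold (.pair (.pair (.pair (.fst (.fst (.var 0))) (.snd (.var 1))) (.snd (.fst (.var 0)))) (.var 2))
    (.pair (.pair (.pair (.fst (.fst (.var 0))) (.fst (.fst (.var 0)))) (.snd (.fst (.var 0))))
      (.snd (.var 0)))
    (.pair (.fst (.var 0)) (.snd (.snd (.var 0)))) (.fst (.snd (.var 0)))

/-- All extensions to the vertex `x` of the colourings in `R`, relative to the colouring `σ`; the
argument is `((x, σ), R)`. -/
def extendVertex : Prog :=
  fold (.letIn (.pair (.pair (.fst (.var 0)) (.var 1))
      (.pair (.letIn (.pair (.var 1) (.snd (.var 0))) append) (.var 2))) recolour) (.lit 0)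
    (.fst (.var 0)) (.snd (.var 0))

/-- All colourings of the vertices in `X` that extend `σ`; the argument is `(X, σ)`. -/
def extensions : Prog :=
  fold (.letIn (.pair (.pair (.var 1) (.var 0)) (.var 2)) extendVertex) (.pair (.lit 0) (.lit 0))
    (.snd (.var 0)) (.fst (.var 0))

end Prog

/-- A list of pairs of vertices as a datum. -/
def Val.ofPairs {n : ℕ} (l : List (Fin n × Fin n)) : Val :=
  .ofList (l.map fun p => .pair (.nat p.1.val) (.nat p.2.val))

/-- The keys of an association list with a given value. -/
def colourClass {n : ℕ} (c : Fin n) (r : List (Fin n × Fin n)) : List (Fin n) :=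
  (r.filter fun p => p.2 = c).map Prod.fst

/-- The sum of the values of the colour classes of a colouring, given as an association list. -/
def listValue {n : ℕ} (v : Finset (Fin n) → ℝ) (r : List (Fin n × Fin n)) : ℝ :=
  ((List.finRange n).map fun c => v (colourClass c r).toFinset).sum

/-- The extensions of the colouring `ξ` to the vertex `x` by `x` or a colour in `τ`. -/
def recolourings {n : ℕ} (x : Fin n) (ξ τ : List (Fin n × Fin n)) : List (List (Fin n × Fin n)) :=
  τ.map (fun p => (x, p.2) :: ξ) ++ [(x, x) :: ξ]

/-- All colourings of the vertices in `X` that extend `σ` and use colours of `σ` or of `X`. -/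
def colourings {n : ℕ} (σ : List (Fin n × Fin n)) : List (Fin n) → List (List (Fin n × Fin n))
  | [] => [[]]
  | x :: X => (colourings σ X).flatMap fun ξ => recolourings x ξ (ξ ++ σ)

/-- A bound `10 ^ 3 ≤ Z` gives room for constants when passing to the next power. -/
theorem mul_pow_le_pow_succ {Z : ℕ} (hZ : 1000 ≤ Z) (k : ℕ) : 1000 * Z ^ k ≤ Z ^ (k + 1) := by
  rw [pow_succ, mul_comm]
  exact Nat.mul_le_mul_left _ hZ

/-! ### Correctness and running time of the list programs. -/

section

variable {O : Oracle} {Γ : List Prog} {ρ : List Val} {Z : ℕ}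

theorem evalIn_eqNat {e₁ e₂ : Prog} {a b : ℕ} {s t : ℕ} (h₁ : EvalIn O Γ ρ e₁ (.nat a) s)
    (h₂ : EvalIn O Γ ρ e₂ (.nat b) t) :
    EvalIn O Γ ρ (.eqNat e₁ e₂) (.nat (if a = b then 1 else 0)) (2 * (s + t) + 10) := by
  have h := EvalIn.bin (op := .le) h₁ h₂ rfl
  have h' := EvalIn.bin (op := .le) h₂ h₁ rfl
  by_cases hab : a ≤ b
  · rw [if_pos hab] at h
    refine ((EvalIn.iteTrue h (by simp) h').mono (by omega) : EvalIn O Γ ρ (.eqNat e₁ e₂) _ _).congr ?_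
    congr 1
    split_ifs <;> omega
  · rw [if_neg hab] at h
    rw [if_neg (by omega)]
    exact (EvalIn.iteFalse h EvalIn.lit).mono (by omega)

theorem evalIn_mem {n : ℕ} {a : Fin n} {l : List (Fin n)} (hZ : 1000 ≤ Z) (hl : l.length ≤ Z) :
    EvalIn O [] [.pair (.nat a) (.ofVertices l)] .mem (.nat (if a ∈ l then 1 else 0)) (Z ^ 2) := by
  refine EvalIn.mono (evalIn_fold (R := fun l : List (Fin n) => .nat (if a ∈ l then 1 else 0))
    (enc := fun i => .nat i.val) (env := .nat a) (c := 120)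
    (EvalIn.of_path rfl) (EvalIn.of_path (by rw [Val.ofVertices_eq]; rfl)) (EvalIn.lit) ?_) ?_
  · intro b l' _
    refine EvalIn.mono ((EvalIn.ite_prop (p := a.val = b.val)
      (evalIn_eqNat (EvalIn.of_path rfl) (EvalIn.of_path rfl))
      (fun _ => EvalIn.of_path rfl) (fun _ => EvalIn.of_path rfl)).congr ?_) (by norm_num)
    simp only [List.mem_cons, Fin.val_inj]
    by_cases h : a = b <;> simp [h]
  · have := Nat.mul_le_mul_left Z hZ
    rw [pow_two]
    omega

theorem evalIn_nthBody {l : List Val} {i : ℕ} {y : Val} (h : l[i]? = some y) :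
    EvalIn O [.nthBody] [.pair (.nat i) (.ofList l)] .nthBody y (i * 200 + 100) := by
  induction i generalizing l with
  | zero =>
    obtain ⟨a, l, rfl⟩ : ∃ a l', l = a :: l' := by
      cases l with
      | nil => simp at h
      | cons a l => exact ⟨a, l, rfl⟩
    simp only [List.getElem?_cons_zero, Option.some.injEq] at h
    subst h
    exact (EvalIn.iteFalse (EvalIn.of_path rfl) (EvalIn.of_path rfl)).mono (by omega)
  | succ i ih =>
    obtain ⟨a, l, rfl⟩ : ∃ a l', l = a :: l' := by
      cases l with
      | nil => simp at h
      | cons a l => exact ⟨a, l, rfl⟩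
    simp only [List.getElem?_cons_succ] at h
    refine (EvalIn.iteTrue (EvalIn.of_path rfl) (by simp) (EvalIn.call (EvalIn.pair
      (EvalIn.bin (EvalIn.of_path rfl) (EvalIn.of_path rfl) (z := .nat i) rfl)
      (EvalIn.of_path rfl)) rfl (ih h))).mono (by omega)

theorem evalIn_nth {l : List Val} {i : ℕ} {y : Val} (hZ : 1000 ≤ Z) (hl : l.length ≤ Z)
    (h : l[i]? = some y) :
    EvalIn O [] [.pair (.nat i) (.ofList l)] .nth y (Z ^ 2) := by
  have hi := (List.getElem?_eq_some_iff.1 h).1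
  refine EvalIn.mono (EvalIn.letRec (EvalIn.call (EvalIn.of_path rfl) rfl (evalIn_nthBody h))) ?_
  have := Nat.mul_le_mul_left Z hZ
  rw [pow_two]
  omega

theorem evalIn_indicesBody {l : List Val} (i : ℕ) :
    EvalIn O [.indicesBody] [.pair (.nat i) (.ofList l)] .indicesBody
      (.ofNats (List.range' i l.length)) (l.length * 200 + 100) := by
  induction l generalizing i with
  | nil => exact (EvalIn.iteFalse (EvalIn.of_path rfl) (EvalIn.of_path rfl)).mono (by omega)
  | cons a l ih =>
    refine (EvalIn.iteTrue (x := .ofList (a :: l)) (EvalIn.of_path rfl) (by simp [Val.ofList])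
      (EvalIn.pair (EvalIn.of_path rfl) (EvalIn.call (EvalIn.pair
      (EvalIn.bin (EvalIn.of_path rfl) (EvalIn.of_path rfl) (z := .nat (i + 1)) rfl)
      (EvalIn.of_path rfl)) rfl (ih (i + 1))))).mono ?_
    simp only [List.length_cons]
    omega

theorem evalIn_indices {l : List Val} (hZ : 1000 ≤ Z) (hl : l.length ≤ Z) :
    EvalIn O [] [.ofList l] .indices (.ofNats (List.range l.length)) (Z ^ 2) := by
  rw [List.range_eq_range']
  refine EvalIn.mono (EvalIn.letRec (EvalIn.call (EvalIn.of_path rfl) rfl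
    (evalIn_indicesBody 0))) ?_
  have := Nat.mul_le_mul_left Z hZ
  rw [pow_two]
  omega

theorem evalIn_indices_ofVertices {n : ℕ} {W : List (Fin n)} (hZ : 1000 ≤ Z) (hW : W.length ≤ Z) :
    EvalIn O [] [.ofVertices W] .indices (.ofVertices (List.finRange W.length)) (Z ^ 2) := by
  have h := evalIn_indices (O := O) (l := W.map fun i => .nat i.val) hZ (by simpa using hW)
  rwa [← Val.ofVertices_eq, List.length_map, ← List.map_coe_finRange_eq_range] at h

theorem evalIn_append {A : Type*} {enc : A → Val} {l₁ l₂ : List A} (hZ : 1000 ≤ Z)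
    (hl : l₁.length ≤ Z) :
    EvalIn O [] [.pair (.ofList (l₁.map enc)) (.ofList (l₂.map enc))] .append
      (.ofList ((l₁ ++ l₂).map enc)) (Z ^ 2) := by
  refine EvalIn.mono (evalIn_fold (R := fun l : List A => .ofList ((l ++ l₂).map enc))
    (enc := enc) (env := .ofList (l₂.map enc)) (c := 20)
    (EvalIn.of_path rfl) (EvalIn.of_path rfl) (EvalIn.of_path rfl) ?_) ?_
  · intro b l' _
    exact EvalIn.of_path rfl
  · have := Nat.mul_le_mul_left Z hZ
    rw [pow_two]
    omega

theorem getElem?_map_val {n : ℕ} (W : List (Fin n)) (j : Fin W.length) :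
    (W.map fun i => Val.nat i.val)[j.val]? = some (.nat (W.get j)) := by
  simp

theorem evalIn_row {n : ℕ} {A W : List (Fin n)} {J : List (Fin W.length)} (hZ : 1000 ≤ Z)
    (hA : A.length ≤ Z) (hW : W.length ≤ Z) (hJ : J.length ≤ Z) :
    EvalIn O [] [.pair (.ofVertices A) (.pair (.ofVertices W) (.ofVertices J))] .row
      (.ofVertices (J.filter fun j => W.get j ∈ A)) (Z ^ 4) := by
  refine EvalIn.mono (evalIn_fold
    (R := fun J : List (Fin W.length) => .ofVertices (J.filter fun j => W.get j ∈ A))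
    (enc := fun i => .nat i.val) (env := .pair (.ofVertices A) (.ofVertices W)) (c := 3 * Z ^ 2)
    (EvalIn.of_path rfl) (EvalIn.of_path (by rw [Val.ofVertices_eq J]; rfl)) EvalIn.lit ?_) ?_
  · intro j l' _
    refine EvalIn.mono ((EvalIn.ite_prop (p := W.get j ∈ A)
      (EvalIn.app (EvalIn.pair (EvalIn.app (EvalIn.of_path (by rw [Val.ofVertices_eq W]; rfl))
        (evalIn_nth hZ (by simpa using hW) (getElem?_map_val W j))) (EvalIn.of_path rfl))
        (evalIn_mem hZ hA))
      (fun _ => EvalIn.of_path rfl) (fun _ => EvalIn.of_path rfl)).congr ?_) ?_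
    · simp only [List.filter_cons, decide_eq_true_eq]
      split_ifs <;> rfl
    · have := mul_pow_le_pow_succ hZ 1
      simp only [Nat.reduceAdd, pow_one] at this
      omega
  · have h₁ := Nat.mul_le_mul_right (3 * Z ^ 2 + 100) hJ
    have h₂ := mul_pow_le_pow_succ hZ 1
    have h₃ := mul_pow_le_pow_succ hZ 2
    have h₄ := mul_pow_le_pow_succ hZ 3
    have h₅ : Z * (3 * Z ^ 2 + 100) = 3 * Z ^ 3 + 100 * Z ^ 1 := by ring
    simp only [Nat.reduceAdd, pow_one] at h₂ h₃ h₄ h₅ ⊢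
    omega

/-- Vertices are renamed to their positions in `W`, so the output encodes a graph on `Fin W.length`
and is a valid input for the separator program. -/
theorem evalIn_subgraph {n : ℕ} {G : SimpleGraph (Fin n)} {W : List (Fin n)} (hZ : 1000 ≤ Z)
    (hn : n ≤ Z) (hW : W.length ≤ Z) :
    EvalIn O [] [.pair (encodeGraph G)
      (.pair (.ofVertices W) (.ofVertices (List.finRange W.length)))] .subgraph
      (encodeGraph (G.comap W.get)) (Z ^ 6) := by
  classical
  set A : Fin n → List (Fin n) := fun w => (List.finRange n).filter fun u => G.Adj w u with hA
  set g : Fin n → Val := fun w => .ofVertices ((List.finRange W.length).filter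
    fun j => W.get j ∈ A w) with hg
  -- The adjacency lists are reindexed by the elements of `W` instead of their positions, to match a
  -- fold along `W`.
  have hout : encodeGraph (G.comap W.get) = .ofList (W.map g) := by
    have : W.map g = (List.finRange W.length).map fun i => g (W.get i) := by
      conv_lhs => rw [← List.map_get_finRange W]
      rw [List.map_map]
      rfl
    rw [this, encodeGraph]
    congr 2
    funext i
    rw [hg]
    congr 1
    apply List.filter_congr
    intro j _
    simp [hA]
  rw [hout]
  refine EvalIn.mono (evalIn_fold
    (R := fun W : List (Fin n) => .ofList (W.map g))
    (enc := fun i => .nat i.val) (env := .pair (encodeGraph G)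
      (.pair (.ofVertices W) (.ofVertices (List.finRange W.length)))) (c := 2 * Z ^ 4)
    (EvalIn.of_path rfl) (EvalIn.of_path (by rw [Val.ofVertices_eq W]; rfl)) EvalIn.lit ?_) ?_
  · intro w l' _
    refine EvalIn.mono (EvalIn.pair (EvalIn.app (EvalIn.pair (EvalIn.app (EvalIn.of_path rfl)
        (evalIn_nth (l := (List.finRange n).map fun i => .ofVertices (A i)) (y := .ofVertices (A w))
          hZ (by simpa using hn) (by simp))) (EvalIn.of_path rfl))
        (evalIn_row hZ ?_ hW (by simpa using hW))) (EvalIn.of_path rfl)) ?_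
    · exact (List.length_filter_le _ _).trans (by simpa using hn)
    · have h₂ := mul_pow_le_pow_succ hZ 1
      have h₃ := mul_pow_le_pow_succ hZ 2
      have h₄ := mul_pow_le_pow_succ hZ 3
      simp only [Nat.reduceAdd, pow_one] at h₂ h₃ h₄ ⊢
      omega
  · have h₁ := Nat.mul_le_mul_right (2 * Z ^ 4 + 100) hW
    have h₂ := mul_pow_le_pow_succ hZ 1
    have h₃ := mul_pow_le_pow_succ hZ 2
    have h₄ := mul_pow_le_pow_succ hZ 3
    have h₅ := mul_pow_le_pow_succ hZ 4
    have h₆ := mul_pow_le_pow_succ hZ 5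
    have h₇ : Z * (2 * Z ^ 4 + 100) = 2 * Z ^ 5 + 100 * Z ^ 1 := by ring
    simp only [Nat.reduceAdd, pow_one] at h₂ h₃ h₄ h₅ h₆ h₇ ⊢
    omega

theorem evalIn_select {n : ℕ} (k : Bool) {W : List (Fin n)} {a b J : List (Fin W.length)}
    (hZ : 1000 ≤ Z) (ha : a.length ≤ Z) (hb : b.length ≤ Z) (hW : W.length ≤ Z)
    (hJ : J.length ≤ Z) :
    EvalIn O [] [.pair (.pair (.ofVertices a) (.ofVertices b))
      (.pair (.ofVertices W) (.ofVertices J))] (.select k)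
      (.ofVertices ((J.filter fun j => j ∈ a ∧ (j ∈ b ↔ k = true)).map W.get)) (Z ^ 4) := by
  refine EvalIn.mono (evalIn_fold (R := fun J : List (Fin W.length) =>
      .ofVertices ((J.filter fun j => j ∈ a ∧ (j ∈ b ↔ k = true)).map W.get))
    (enc := fun i => .nat i.val) (env := .pair (.pair (.ofVertices a) (.ofVertices b))
      (.ofVertices W)) (c := 4 * Z ^ 2)
    (EvalIn.of_path rfl) (EvalIn.of_path (by rw [Val.ofVertices_eq J]; rfl)) EvalIn.lit ?_) ?_
  · intro j l' _
    set r := Val.ofVertices ((l'.filter fun j => j ∈ a ∧ (j ∈ b ↔ k = true)).map W.get) with hr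
    have hkeep : ∀ Γ, EvalIn O Γ [.pair (.pair (.ofVertices a) (.ofVertices b)) (.ofVertices W),
        .nat j.val, r]
        (.pair (.letIn (.pair (.var 1) (.snd (.var 0))) .nth) (.var 2))
        (.pair (.nat (W.get j)) r) (Z ^ 2 + 100) := fun Γ =>
      EvalIn.mono (EvalIn.pair (EvalIn.app (EvalIn.of_path (by rw [Val.ofVertices_eq W]; rfl))
        (evalIn_nth hZ (by simpa using hW) (getElem?_map_val W j))) (EvalIn.of_path rfl)) (by omega)
    refine EvalIn.mono (EvalIn.congr (EvalIn.ite_prop (p := j ∈ a)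
      (EvalIn.app (EvalIn.of_path rfl) (evalIn_mem hZ ha))
      (fun _ => EvalIn.ite_prop (p := j ∈ b) (t := Z ^ 2 + 100)
          (y₁ := if k then .pair (.nat (W.get j)) r else r)
          (y₂ := if k then r else .pair (.nat (W.get j)) r)
        (EvalIn.app (EvalIn.of_path rfl) (evalIn_mem hZ hb)) (fun _ => ?_) (fun _ => ?_))
      (fun _ => EvalIn.mono (EvalIn.of_path (y := r) rfl) ?_)) ?_) ?_
    · cases k
      · exact EvalIn.mono (EvalIn.of_path rfl) (by omega)
      · exact hkeep _
    · cases k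
      · exact hkeep _
      · exact EvalIn.mono (EvalIn.of_path rfl) (by omega)
    · omega
    · by_cases h₁ : j ∈ a <;> by_cases h₂ : j ∈ b <;> cases k <;> simp [h₁, h₂, hr] <;> rfl
    · have := mul_pow_le_pow_succ hZ 1
      simp only [Nat.reduceAdd, pow_one] at this
      omega
  · have h₁ := Nat.mul_le_mul_right (4 * Z ^ 2 + 100) hJ
    have h₂ := mul_pow_le_pow_succ hZ 1
    have h₃ := mul_pow_le_pow_succ hZ 2
    have h₄ := mul_pow_le_pow_succ hZ 3
    have h₅ : Z * (4 * Z ^ 2 + 100) = 4 * Z ^ 3 + 100 * Z ^ 1 := by ring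
    simp only [Nat.reduceAdd, pow_one] at h₂ h₃ h₄ h₅ ⊢
    omega

theorem evalIn_fiber {n : ℕ} {c : Fin n} {r : List (Fin n × Fin n)} (hZ : 1000 ≤ Z)
    (hr : r.length ≤ Z) :
    EvalIn O [] [.pair (.nat c) (.ofPairs r)] .fiber (.ofVertices (colourClass c r)) (Z ^ 2) := by
  refine EvalIn.mono (evalIn_fold (R := fun r => .ofVertices (colourClass c r))
    (enc := fun p : Fin n × Fin n => .pair (.nat p.1.val) (.nat p.2.val)) (env := .nat c) (c := 120)
    (EvalIn.of_path rfl) (EvalIn.of_path rfl) EvalIn.lit ?_) ?_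
  · intro p l' _
    refine EvalIn.mono ((EvalIn.ite_prop (p := c.val = p.2.val)
      (evalIn_eqNat (EvalIn.of_path rfl) (EvalIn.of_path rfl))
      (fun _ => EvalIn.of_path rfl) (fun _ => EvalIn.of_path rfl)).congr ?_) (by norm_num)
    simp only [colourClass, List.filter_cons, Fin.val_inj, eq_comm (a := c), decide_eq_true_eq]
    split_ifs <;> rfl
  · have := Nat.mul_le_mul_left Z hZ
    rw [pow_two]
    omega

theorem valuationOracle_ofVertices {n : ℕ} (v : Finset (Fin n) → ℝ) (l : List (Fin n)) :
    valuationOracle v (l.map Fin.val).toFinset = some (v l.toFinset) := by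
  rw [valuationOracle]
  congr 2
  ext i
  simp [Fin.val_inj]

theorem evalIn_value {n : ℕ} {v : Finset (Fin n) → ℝ} (hv : v ∅ = 0) {r : List (Fin n × Fin n)}
    (hZ : 1000 ≤ Z) (hn : n ≤ Z) (hr : r.length ≤ Z) :
    EvalIn (valuationOracle v) [] [.pair (.ofVertices (List.finRange n)) (.ofPairs r)] .value
      (.real (listValue v r)) (Z ^ 4) := by
  refine EvalIn.mono (evalIn_fold
    (R := fun V => .real (V.map fun c => v (colourClass c r).toFinset).sum)
    (enc := fun i : Fin n => .nat i.val) (env := .ofPairs r) (c := 2 * Z ^ 2)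
    (EvalIn.of_path rfl) (EvalIn.of_path (by rw [Val.ofVertices_eq]; rfl))
    -- The language has no real constants; the real zero is obtained as the value of the empty
    -- coalition.
    (EvalIn.query (l := []) EvalIn.lit (by simpa [hv] using valuationOracle_ofVertices v [])) ?_) ?_
  · intro c l' _
    refine EvalIn.mono (EvalIn.bin (EvalIn.query (EvalIn.app (EvalIn.of_path rfl)
      (evalIn_fiber hZ hr)) (valuationOracle_ofVertices v _)) (EvalIn.of_path rfl) ?_) ?_
    · simp [BinOp.app]
    · have := mul_pow_le_pow_succ hZ 1
      simp only [Nat.reduceAdd, pow_one] at this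
      omega
  · have h₁ := Nat.mul_le_mul_right (2 * Z ^ 2 + 100) hn
    have h₂ := mul_pow_le_pow_succ hZ 1
    have h₃ := mul_pow_le_pow_succ hZ 2
    have h₄ := mul_pow_le_pow_succ hZ 3
    have h₅ : Z * (2 * Z ^ 2 + 100) = 2 * Z ^ 3 + 100 * Z ^ 1 := by ring
    simp only [Nat.reduceAdd, pow_one, List.length_finRange] at h₂ h₃ h₄ h₅ ⊢
    omega

theorem evalIn_classes {n : ℕ} {r : List (Fin n × Fin n)} (hZ : 1000 ≤ Z) (hn : n ≤ Z)
    (hr : r.length ≤ Z) :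
    EvalIn O [] [.pair (.ofVertices (List.finRange n)) (.ofPairs r)] .classes
      (.ofList ((((List.finRange n).map fun c => colourClass c r).filter (· ≠ [])).map
        Val.ofVertices)) (Z ^ 4) := by
  refine EvalIn.mono (evalIn_fold
    (R := fun V => .ofList (((V.map fun c => colourClass c r).filter (· ≠ [])).map Val.ofVertices))
    (enc := fun i : Fin n => .nat i.val) (env := .ofPairs r) (c := 2 * Z ^ 2)
    (EvalIn.of_path rfl) (EvalIn.of_path (by rw [Val.ofVertices_eq]; rfl)) EvalIn.lit ?_) ?_
  · intro c l' _
    refine EvalIn.mono (EvalIn.letIn (t := 50) (EvalIn.app (EvalIn.of_path rfl)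
      (evalIn_fiber hZ hr)) ?_) ?_
    · by_cases hc : colourClass c r = []
      · rw [hc]
        refine EvalIn.mono ((EvalIn.iteFalse (EvalIn.of_path rfl) (EvalIn.of_path rfl)).congr ?_)
          (by norm_num)
        simp [hc]
      · obtain ⟨a, l, hal⟩ := List.exists_cons_of_ne_nil hc
        refine EvalIn.mono ((EvalIn.iteTrue (EvalIn.of_path rfl) ?_ (EvalIn.of_path rfl)).congr ?_)
          (by norm_num)
        · rw [hal, Val.ofVertices_eq]
          simp [Val.ofList]
        · simp [hc, Val.ofList]
    · have := mul_pow_le_pow_succ hZ 1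
      simp only [Nat.reduceAdd, pow_one] at this
      omega
  · have h₁ := Nat.mul_le_mul_right (2 * Z ^ 2 + 100) hn
    have h₂ := mul_pow_le_pow_succ hZ 1
    have h₃ := mul_pow_le_pow_succ hZ 2
    have h₄ := mul_pow_le_pow_succ hZ 3
    have h₅ : Z * (2 * Z ^ 2 + 100) = 2 * Z ^ 3 + 100 * Z ^ 1 := by ring
    simp only [Nat.reduceAdd, pow_one, List.length_finRange] at h₂ h₃ h₄ h₅ ⊢
    omega

/-- A list of colourings as a datum. -/
def Val.ofColourings {n : ℕ} (L : List (List (Fin n × Fin n))) : Val := .ofList (L.map Val.ofPairs)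

theorem evalIn_recolour {n : ℕ} {x : Fin n} {ξ τ : List (Fin n × Fin n)}
    {R : List (List (Fin n × Fin n))} (hZ : 1000 ≤ Z) (hτ : τ.length ≤ Z) :
    EvalIn O [] [.pair (.pair (.nat x) (.ofPairs ξ)) (.pair (.ofPairs τ) (.ofColourings R))]
      .recolour (.ofColourings (recolourings x ξ τ ++ R)) (Z ^ 2) := by
  refine EvalIn.mono (evalIn_fold (R := fun τ => .ofColourings (recolourings x ξ τ ++ R))
    (enc := fun p : Fin n × Fin n => .pair (.nat p.1.val) (.nat p.2.val))
    (env := .pair (.pair (.nat x) (.ofPairs ξ)) (.ofColourings R)) (c := 20)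
    (EvalIn.of_path rfl) (EvalIn.of_path rfl) (EvalIn.of_path rfl) ?_) ?_
  · intro p l' _
    exact EvalIn.of_path rfl
  · have := Nat.mul_le_mul_left Z hZ
    rw [pow_two]
    omega

theorem evalIn_extendVertex {n : ℕ} {x : Fin n} {σ : List (Fin n × Fin n)}
    {R : List (List (Fin n × Fin n))} (hZ : 1000 ≤ Z) (hR : ∀ ξ ∈ R, (ξ ++ σ).length ≤ Z) :
    EvalIn O [] [.pair (.pair (.nat x) (.ofPairs σ)) (.ofColourings R)] .extendVertex
      (.ofColourings (R.flatMap fun ξ => recolourings x ξ (ξ ++ σ)))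
      (R.length * Z ^ 3 + 200) := by
  refine EvalIn.mono (evalIn_fold
    (R := fun R => .ofColourings (R.flatMap fun ξ => recolourings x ξ (ξ ++ σ)))
    (enc := Val.ofPairs) (env := .pair (.nat x) (.ofPairs σ)) (c := 3 * Z ^ 2)
    (EvalIn.of_path rfl) (EvalIn.of_path rfl) EvalIn.lit ?_) ?_
  · intro ξ l' hl
    have hξ := hR ξ (hl.subset List.mem_cons_self)
    refine EvalIn.mono (EvalIn.app (EvalIn.pair (EvalIn.of_path rfl) (EvalIn.pair
      (EvalIn.app (EvalIn.of_path rfl) (evalIn_append hZ (by simp at hξ; omega)))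
      (EvalIn.of_path rfl))) (evalIn_recolour hZ hξ)) ?_
    have := mul_pow_le_pow_succ hZ 1
    simp only [Nat.reduceAdd, pow_one] at this
    omega
  · have h₁ := mul_pow_le_pow_succ hZ 1
    have h₂ := mul_pow_le_pow_succ hZ 2
    simp only [Nat.reduceAdd, pow_one] at h₁ h₂
    have := Nat.mul_le_mul_left R.length (show 3 * Z ^ 2 + 100 ≤ Z ^ 3 by omega)
    omega

theorem map_fst_of_mem_colourings {n : ℕ} {σ : List (Fin n × Fin n)} {X : List (Fin n)}
    {ξ : List (Fin n × Fin n)} (h : ξ ∈ colourings σ X) : ξ.map Prod.fst = X := by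
  induction X generalizing ξ with
  | nil => simp only [colourings, List.mem_singleton] at h; simp [h]
  | cons x X ih =>
    simp only [colourings, recolourings, List.mem_flatMap, List.mem_append, List.mem_map,
      List.mem_singleton] at h
    obtain ⟨ξ', h', ⟨p, -, rfl⟩ | rfl⟩ := h <;> simp [ih h']

/-- Each vertex chooses its own name or the colour of an entry already present, which is at most `m`
choices. -/
theorem length_colourings_le {n : ℕ} (σ : List (Fin n × Fin n)) (X : List (Fin n)) (m : ℕ)
    (h : σ.length + X.length ≤ m) : (colourings σ X).length ≤ m ^ X.length := by
  induction X with
  | nil => simp [colourings]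
  | cons x X ih =>
    simp only [colourings, List.length_flatMap, List.length_cons] at h ⊢
    rw [pow_succ]
    refine (List.sum_le_card_nsmul _ m ?_).trans ?_
    · intro k hk
      obtain ⟨ξ, hξ, rfl⟩ := List.mem_map.1 hk
      have := congrArg List.length (map_fst_of_mem_colourings hξ)
      simp only [List.length_map] at this
      simp only [recolourings, List.length_append, List.length_map, List.length_singleton]
      omega
    · simpa using Nat.mul_le_mul_right m (ih (by omega))

/-- The fold builds the colourings of every suffix of `X` on the way, hence a bound `M` for all
suffixes; the empty suffix gives `1 ≤ M`, which pays for the constants. -/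
theorem evalIn_extensions {n : ℕ} {X : List (Fin n)} {σ : List (Fin n × Fin n)} {M : ℕ}
    (hZ : 1000 ≤ Z) (hX : X.length ≤ Z) (hσ : X.length + σ.length ≤ Z)
    (hM : ∀ X', X' <:+ X → (colourings σ X').length ≤ M) :
    EvalIn O [] [.pair (.ofVertices X) (.ofPairs σ)] .extensions
      (.ofColourings (colourings σ X)) (Z ^ 5 * M) := by
  have hM' : 1 ≤ M := hM [] (List.nil_suffix)
  refine EvalIn.mono (evalIn_fold (R := fun X => .ofColourings (colourings σ X))
    (enc := fun i => .nat i.val) (env := .ofPairs σ) (c := 2 * Z ^ 3 * M)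
    (EvalIn.of_path rfl) (EvalIn.of_path (by rw [Val.ofVertices_eq X]; rfl))
    (EvalIn.of_path rfl) ?_) ?_
  · intro x X' hX'
    have hsuff : X' <:+ X := (List.suffix_cons _ _).trans hX'
    refine EvalIn.mono (EvalIn.app (EvalIn.of_path rfl) (evalIn_extendVertex hZ ?_)) ?_
    · intro ξ hξ
      have := congrArg List.length (map_fst_of_mem_colourings hξ)
      have := hsuff.length_le
      simp only [List.length_map] at *
      simp only [List.length_append]
      omega
    · have h₁ := mul_pow_le_pow_succ hZ 1
      have h₂ := mul_pow_le_pow_succ hZ 2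
      simp only [Nat.reduceAdd, pow_one] at h₁ h₂
      have h₃ := Nat.mul_le_mul_right (Z ^ 3) (hM X' hsuff)
      have h₄ := Nat.mul_le_mul_left (Z ^ 3) hM'
      have h₅ : 2 * Z ^ 3 * M = M * Z ^ 3 + Z ^ 3 * M := by ring
      omega
  · have h₁ := Nat.mul_le_mul_right (2 * Z ^ 3 * M + 100) hX
    have h₂ : Z * (2 * Z ^ 3 * M + 100) = 2 * (Z ^ 4 * M) + 100 * Z := by ring
    have h₃ := Nat.mul_le_mul_right M (mul_pow_le_pow_succ hZ 4)
    have h₄ := Nat.mul_le_mul_left (Z ^ 4) hM'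
    have h₅ := mul_pow_le_pow_succ hZ 1
    have h₆ := mul_pow_le_pow_succ hZ 2
    have h₇ := mul_pow_le_pow_succ hZ 3
    simp only [Nat.reduceAdd, pow_one, mul_assoc] at *
    omega

end

/-! ### Values of colourings -/

section

variable {n : ℕ} {G : SimpleGraph (Fin n)} {v : Finset (Fin n) → ℝ}

/-- The marginal contribution of `j` is unchanged when the vertices of `S₁` join one by one, each
exchange being an instance of the IDM identity; vertices already present change nothing. -/
theorem IsIDM.insert_add (hv : IsIDM G v) (S₀ : Finset (Fin n)) (j : Fin n) (S₁ : Finset (Fin n))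
    (h : ∀ i ∈ S₁, i ≠ j ∧ ¬ G.Adj i j) :
    v (insert j (S₀ ∪ S₁)) + v S₀ = v (S₀ ∪ S₁) + v (insert j S₀) := by
  by_cases hj : j ∈ S₀
  · rw [Finset.insert_eq_of_mem hj, Finset.insert_eq_of_mem (Finset.mem_union_left _ hj)]
  induction S₁ using Finset.induction_on with
  | empty => simp [add_comm]
  | insert i S₁ hi ih =>
    have ih := ih fun i hi => h i (Finset.mem_insert_of_mem hi)
    have hij := h i (Finset.mem_insert_self _ _)
    rw [Finset.union_insert]
    by_cases hi' : i ∈ S₀ ∪ S₁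
    · rwa [Finset.insert_eq_of_mem hi']
    have hj' : j ∉ S₀ ∪ S₁ := by
      rw [Finset.mem_union, not_or]
      exact ⟨hj, fun hj => (h j (Finset.mem_insert_of_mem hj)).1 rfl⟩
    have := hv (S₀ ∪ S₁) i j hi' hj' hij.1 hij.2
    rw [show S₀ ∪ S₁ ∪ {i} = insert i (S₀ ∪ S₁) by ext; simp,
      show S₀ ∪ S₁ ∪ {i, j} = insert j (insert i (S₀ ∪ S₁)) by ext; simp; tauto,
      show S₀ ∪ S₁ ∪ {j} = insert j (S₀ ∪ S₁) by ext; simp] at this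
    linarith

/-- A function that is independent of disconnected members decomposes along separations. -/
theorem IsIDM.union_add (hv : IsIDM G v) (S₀ S₁ S₂ : Finset (Fin n))
    (h : ∀ i ∈ S₁, ∀ j ∈ S₂, i ≠ j ∧ ¬ G.Adj i j) :
    v (S₀ ∪ S₁ ∪ S₂) + v S₀ = v (S₀ ∪ S₁) + v (S₀ ∪ S₂) := by
  induction S₂ using Finset.induction_on with
  | empty => simp
  | insert j S₂ hj ih =>
    have ih := ih fun i hi j hj => h i hi j (Finset.mem_insert_of_mem hj)
    -- The marginal contribution of `j` is the same with and without `S₁`; adding this to the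
    -- hypothesis for the smaller `S₂` telescopes.
    have := hv.insert_add (S₀ ∪ S₂) j S₁ fun i hi => h i hi j (Finset.mem_insert_self _ _)
    rw [Finset.union_insert, Finset.union_insert]
    rw [Finset.union_right_comm] at this
    linarith

/-- The sum of the values of the classes of the colouring `κ` of `Y`. -/
def colouringValue (v : Finset (Fin n) → ℝ) (Y : Finset (Fin n)) (κ : Fin n → Fin n) : ℝ :=
  ∑ c, v (Y.filter fun i => κ i = c)

/-- Unused colours contribute `v ∅ = 0` and distinct used colours have distinct classes. The value
therefore depends on the partition alone, not on the names of the colours. -/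
theorem colouringValue_eq_sum_image (h₀ : v ∅ = 0) (Y : Finset (Fin n)) (κ : Fin n → Fin n) :
    colouringValue v Y κ = ∑ C ∈ Y.image (fun i => Y.filter fun j => κ j = κ i), v C := by
  rw [show (fun i => Y.filter fun j => κ j = κ i) = (fun c => Y.filter fun j => κ j = c) ∘ κ from rfl,
    ← Finset.image_image, Finset.sum_image, colouringValue]
  · refine (Finset.sum_subset (Finset.subset_univ _) fun c _ hc => ?_).symm
    rw [Finset.filter_eq_empty_iff.2, h₀]
    intro i hi hic
    exact hc (Finset.mem_image.2 ⟨i, hi, hic⟩)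
  · intro c hc d _ hcd
    obtain ⟨i, hi, rfl⟩ := Finset.mem_image.1 (Finset.mem_coe.1 hc)
    have : i ∈ Y.filter fun j => κ j = d := by
      rw [← show _ = Y.filter fun j => κ j = d from hcd]
      simp [hi]
    exact (Finset.mem_filter.1 this).2

theorem colouringValue_congr (h₀ : v ∅ = 0) {Y : Finset (Fin n)} {κ κ' : Fin n → Fin n}
    (h : ∀ i ∈ Y, ∀ j ∈ Y, κ i = κ j ↔ κ' i = κ' j) :
    colouringValue v Y κ = colouringValue v Y κ' := by
  rw [colouringValue_eq_sum_image h₀, colouringValue_eq_sum_image h₀]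
  congr 1
  refine Finset.image_congr fun i hi => Finset.filter_congr fun j hj => h j hj i hi

/-- The decomposition for `v` is applied to each colour class and summed over the colours. -/
theorem IsIDM.colouringValue_union_add (hv : IsIDM G v) (S₀ S₁ S₂ : Finset (Fin n))
    (h : ∀ i ∈ S₁, ∀ j ∈ S₂, i ≠ j ∧ ¬ G.Adj i j) (κ : Fin n → Fin n) :
    colouringValue v (S₀ ∪ S₁ ∪ S₂) κ + colouringValue v S₀ κ =
      colouringValue v (S₀ ∪ S₁) κ + colouringValue v (S₀ ∪ S₂) κ := by
  simp only [colouringValue, ← Finset.sum_add_distrib, Finset.filter_union]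
  refine Finset.sum_congr rfl fun c _ => hv.union_add _ _ _ fun i hi j hj =>
    h i (Finset.mem_filter.1 hi).1 j (Finset.mem_filter.1 hj).1

theorem listValue_eq_colouringValue {r : List (Fin n × Fin n)} {κ : Fin n → Fin n}
    (h : ∀ p ∈ r, κ p.1 = p.2) :
    listValue v r = colouringValue v (r.map Prod.fst).toFinset κ := by
  rw [listValue, colouringValue, ← List.ofFn_eq_map, List.sum_ofFn]
  refine Finset.sum_congr rfl fun c _ => ?_
  congr 1
  ext i
  simp only [colourClass, List.mem_toFinset, List.mem_map, List.mem_filter, decide_eq_true_eq,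
    Finset.mem_filter]
  constructor
  · rintro ⟨p, ⟨hp, rfl⟩, rfl⟩
    exact ⟨⟨p, hp, rfl⟩, h p hp⟩
  · rintro ⟨⟨p, hp, rfl⟩, hc⟩
    exact ⟨p, ⟨hp, by rw [← h p hp, hc]⟩, rfl⟩

theorem exists_colouring {r : List (Fin n × Fin n)} (h : (r.map Prod.fst).Nodup) :
    ∃ κ : Fin n → Fin n, ∀ p ∈ r, κ p.1 = p.2 := by
  induction r with
  | nil => exact ⟨id, by simp⟩
  | cons p r ih =>
    rw [List.map_cons, List.nodup_cons] at h
    obtain ⟨κ, hκ⟩ := ih h.2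
    refine ⟨Function.update κ p.1 p.2, fun q hq => ?_⟩
    rcases List.mem_cons.1 hq with rfl | hq
    · simp
    · rw [Function.update_of_ne, hκ q hq]
      rintro heq
      exact h.1 (heq ▸ List.mem_map_of_mem hq)

/-- The colouring `κ` and the list `σ` induce the same partition of the vertices in `σ`. -/
def Agree (κ : Fin n → Fin n) (σ : List (Fin n × Fin n)) : Prop :=
  ∀ p ∈ σ, ∀ q ∈ σ, κ p.1 = κ q.1 ↔ p.2 = q.2

theorem Agree.colouringValue_eq (h₀ : v ∅ = 0) {κ : Fin n → Fin n} {σ : List (Fin n × Fin n)}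
    (h : Agree κ σ) (hσ : (σ.map Prod.fst).Nodup) :
    colouringValue v (σ.map Prod.fst).toFinset κ = listValue v σ := by
  obtain ⟨κ', hκ'⟩ := exists_colouring hσ
  rw [listValue_eq_colouringValue hκ']
  refine colouringValue_congr h₀ fun i hi j hj => ?_
  obtain ⟨p, hp, rfl⟩ := List.mem_map.1 (List.mem_toFinset.1 hi)
  obtain ⟨q, hq, rfl⟩ := List.mem_map.1 (List.mem_toFinset.1 hj)
  rw [hκ' p hp, hκ' q hq, h p hp q hq]

/-- Colours are always names of coloured vertices. This is why the name of an uncoloured vertex is a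
fresh colour. -/
theorem colours_subset_of_mem_colourings {σ : List (Fin n × Fin n)} {X : List (Fin n)}
    (hσ : ∀ p ∈ σ, p.2 ∈ σ.map Prod.fst) {ξ : List (Fin n × Fin n)} (h : ξ ∈ colourings σ X) :
    ∀ p ∈ ξ ++ σ, p.2 ∈ (ξ ++ σ).map Prod.fst := by
  induction X generalizing ξ with
  | nil =>
    simp only [colourings, List.mem_singleton] at h
    subst h
    exact hσ
  | cons x X ih =>
    simp only [colourings, recolourings, List.mem_flatMap, List.mem_append (t := [_]),
      List.mem_map (l := _ ++ _), List.mem_singleton] at h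
    obtain ⟨ξ', h', ⟨q, hq, rfl⟩ | rfl⟩ := h
    · intro p hp
      rw [List.cons_append] at hp ⊢
      rw [List.map_cons]
      rcases List.mem_cons.1 hp with rfl | hp
      · exact List.mem_cons_of_mem _ (ih h' q hq)
      · exact List.mem_cons_of_mem _ (ih h' p hp)
    · intro p hp
      rw [List.cons_append] at hp ⊢
      rw [List.map_cons]
      rcases List.mem_cons.1 hp with rfl | hp
      · exact List.mem_cons_self
      · exact List.mem_cons_of_mem _ (ih h' p hp)

/-- The search is exhaustive up to renaming colours: if the `κ`-class of `x` meets the vertices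
coloured so far, the colour used there is repeated; otherwise `x` opens a new class under its own
name. -/
theorem Agree.exists_mem_colourings {κ : Fin n → Fin n} {σ : List (Fin n × Fin n)}
    (h : Agree κ σ) (hσ : ∀ p ∈ σ, p.2 ∈ σ.map Prod.fst) (X : List (Fin n))
    (hX : (X ++ σ.map Prod.fst).Nodup) : ∃ ξ ∈ colourings σ X, Agree κ (ξ ++ σ) := by
  induction X with
  | nil => exact ⟨[], by simp [colourings], h⟩
  | cons x X ih =>
    rw [List.cons_append, List.nodup_cons] at hX
    obtain ⟨ξ, hξ, ha⟩ := ih hX.2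
    have hcol := colours_subset_of_mem_colourings hσ hξ
    have hx : x ∉ (ξ ++ σ).map Prod.fst := by
      rw [List.map_append, map_fst_of_mem_colourings hξ]
      exact hX.1
    by_cases hc : ∃ p ∈ ξ ++ σ, κ p.1 = κ x
    · obtain ⟨p, hp, hpx⟩ := hc
      refine ⟨(x, p.2) :: ξ, ?_, ?_⟩
      · simp only [colourings, recolourings, List.mem_flatMap, List.mem_append (t := [_])]
        exact ⟨ξ, hξ, Or.inl (List.mem_map.2 ⟨p, hp, rfl⟩)⟩
      · intro q hq q' hq'
        rw [List.cons_append] at hq hq'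
        rcases List.mem_cons.1 hq with rfl | hq <;> rcases List.mem_cons.1 hq' with rfl | hq'
        · simp
        · rw [← ha p hp q' hq', hpx]
        · rw [← ha q hq p hp, hpx]
        · exact ha q hq q' hq'
    · refine ⟨(x, x) :: ξ, ?_, ?_⟩
      · simp only [colourings, recolourings, List.mem_flatMap, List.mem_append (t := [_])]
        exact ⟨ξ, hξ, Or.inr (List.mem_singleton_self _)⟩
      · have hne : ∀ q ∈ ξ ++ σ, κ q.1 ≠ κ x ∧ q.2 ≠ x := fun q hq =>
          ⟨fun h => hc ⟨q, hq, h⟩, fun h => hx (h ▸ hcol q hq)⟩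
        intro q hq q' hq'
        rw [List.cons_append] at hq hq'
        rcases List.mem_cons.1 hq with rfl | hq <;> rcases List.mem_cons.1 hq' with rfl | hq'
        · simp
        · simp [(hne q' hq').1.symm, (hne q' hq').2.symm]
        · simp [(hne q hq).1, (hne q hq).2]
        · exact ha q hq q' hq'

/-- The list `τ` is an optimal colouring of the vertices in `W` that extends `σ`. -/
structure IsOptimal (v : Finset (Fin n) → ℝ) (W : List (Fin n)) (σ τ : List (Fin n × Fin n)) :
    Prop where
  perm : (τ.map Prod.fst).Perm W
  le : ∀ κ, Agree κ σ →
    colouringValue v (W.toFinset ∪ (σ.map Prod.fst).toFinset) κ ≤ listValue v (τ ++ σ)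

theorem IsOptimal.nil (h₀ : v ∅ = 0) {σ : List (Fin n × Fin n)} (hσ : (σ.map Prod.fst).Nodup) :
    IsOptimal v [] σ [] where
  perm := .refl _
  le κ h := by simpa using (h.colouringValue_eq h₀ hσ).le

/-- Given a competitor `κ`, choose the `ξ` that induces the same partition of the set `S` of
vertices of `ξ ++ σ`. The values of `κ` and of the candidate for `ξ` both split into the value on `S
∪ W₁` plus that on `S ∪ W₂` minus that on `S`. The subtracted terms coincide, and the other two are
compared by optimality of `τ₁ ξ` and `τ₂ ξ`. -/
theorem IsIDM.isOptimal (hv : IsIDM G v) (h₀ : v ∅ = 0) {W X W₁ W₂ : List (Fin n)}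
    {σ : List (Fin n × Fin n)} (hW : W.Perm (X ++ (W₁ ++ W₂)))
    (hnd : (W ++ σ.map Prod.fst).Nodup) (hσ : ∀ p ∈ σ, p.2 ∈ σ.map Prod.fst)
    (hadj : ∀ i ∈ W₁, ∀ j ∈ W₂, ¬ G.Adj i j)
    {τ₁ τ₂ : List (Fin n × Fin n) → List (Fin n × Fin n)}
    (h₁ : ∀ ξ ∈ colourings σ X, IsOptimal v W₁ (ξ ++ σ) (τ₁ ξ))
    (h₂ : ∀ ξ ∈ colourings σ X, IsOptimal v W₂ (ξ ++ σ) (τ₂ ξ))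
    {τ : List (Fin n × Fin n)}
    (hτ : ∃ ξ ∈ colourings σ X, τ = ξ ++ (τ₁ ξ ++ τ₂ ξ))
    (hmax : ∀ ξ ∈ colourings σ X,
      listValue v (ξ ++ (τ₁ ξ ++ τ₂ ξ) ++ σ) ≤ listValue v (τ ++ σ)) :
    IsOptimal v W σ τ := by
  have hperm : ∀ ξ ∈ colourings σ X, ((ξ ++ (τ₁ ξ ++ τ₂ ξ)).map Prod.fst).Perm W := fun ξ hξ => by
    rw [List.map_append, List.map_append, map_fst_of_mem_colourings hξ]
    exact (List.Perm.append_left _ ((h₁ ξ hξ).perm.append (h₂ ξ hξ).perm)).trans hW.symm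
  refine ⟨?_, fun κ hκ => ?_⟩
  · obtain ⟨ξ, hξ, rfl⟩ := hτ
    exact hperm ξ hξ
  have hnd' : (X ++ (W₁ ++ W₂) ++ σ.map Prod.fst).Nodup := (hW.append_right _).nodup_iff.1 hnd
  obtain ⟨ξ, hξ, hκξ⟩ := hκ.exists_mem_colourings hσ X (by
    refine hnd'.sublist ?_
    simp)
  have hkeys := map_fst_of_mem_colourings hξ
  refine le_trans ?_ (hmax ξ hξ)
  -- The candidate list is turned into a total function, so that the decomposition applies to it as
  -- well as to `κ`.
  obtain ⟨κ', hκ'⟩ := exists_colouring (r := ξ ++ (τ₁ ξ ++ τ₂ ξ) ++ σ) (by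
    rw [List.map_append]
    exact ((hperm ξ hξ).append_right _).nodup_iff.2 hnd)
  have hdisj : ∀ i ∈ W₁.toFinset, ∀ j ∈ W₂.toFinset, i ≠ j ∧ ¬ G.Adj i j := by
    intro i hi j hj
    rw [List.mem_toFinset] at hi hj
    refine ⟨?_, hadj i hi j hj⟩
    have := (List.nodup_append.1 (List.nodup_append.1 (List.nodup_append.1 hnd').1).2.1).2.2
    exact this i hi j hj
  set S := ((ξ ++ σ).map Prod.fst).toFinset with hS
  have hset : W.toFinset ∪ (σ.map Prod.fst).toFinset = S ∪ W₁.toFinset ∪ W₂.toFinset := by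
    ext i
    simp only [hS, List.map_append, hkeys, Finset.mem_union, List.mem_toFinset, hW.mem_iff,
      List.mem_append]
    tauto
  have hset' : ((ξ ++ (τ₁ ξ ++ τ₂ ξ) ++ σ).map Prod.fst).toFinset =
      S ∪ W₁.toFinset ∪ W₂.toFinset := by
    rw [← hset]
    ext i
    simp only [List.map_append (l₂ := σ), Finset.mem_union, List.mem_toFinset,
      List.mem_append (t := σ.map Prod.fst), (hperm ξ hξ).mem_iff]
  rw [listValue_eq_colouringValue hκ', hset, hset']
  have e₁ := hv.colouringValue_union_add S _ _ hdisj κ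
  have e₂ := hv.colouringValue_union_add S _ _ hdisj κ'
  have hSnd : ((ξ ++ σ).map Prod.fst).Nodup := by
    rw [List.map_append, hkeys]
    exact hnd'.sublist (by simp)
  have e₃ := hκξ.colouringValue_eq h₀ hSnd
  have e₄ : listValue v (ξ ++ σ) = colouringValue v S κ' := listValue_eq_colouringValue fun p hp =>
    hκ' p (by simp only [List.mem_append] at hp ⊢; tauto)
  have e₅ : listValue v (τ₁ ξ ++ (ξ ++ σ)) = colouringValue v (S ∪ W₁.toFinset) κ' := by
    rw [listValue_eq_colouringValue (κ := κ') fun p hp =>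
      hκ' p (by simp only [List.mem_append] at hp ⊢; tauto)]
    congr 1
    ext i
    rw [List.map_append, List.mem_toFinset, List.mem_append, (h₁ ξ hξ).perm.mem_iff,
      Finset.mem_union, hS, List.mem_toFinset, List.mem_toFinset, or_comm]
  have e₆ : listValue v (τ₂ ξ ++ (ξ ++ σ)) = colouringValue v (S ∪ W₂.toFinset) κ' := by
    rw [listValue_eq_colouringValue (κ := κ') fun p hp =>
      hκ' p (by simp only [List.mem_append] at hp ⊢; tauto)]
    congr 1
    ext i
    rw [List.map_append, List.mem_toFinset, List.mem_append, (h₂ ξ hξ).perm.mem_iff,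
      Finset.mem_union, hS, List.mem_toFinset, List.mem_toFinset, or_comm]
  have l₁ := (h₁ ξ hξ).le κ hκξ
  have l₂ := (h₂ ξ hξ).le κ hκξ
  rw [Finset.union_comm, ← hS, e₅] at l₁
  rw [Finset.union_comm, ← hS, e₆] at l₂
  linarith

end

/-! ### Coalition structures and colourings -/

/-- Each vertex is coloured by the least member of its coalition. -/
theorem CoalitionStructure.exists_value_eq {n : ℕ} {v : Finset (Fin n) → ℝ} (h₀ : v ∅ = 0)
    (Q : CoalitionStructure n) :
    ∃ κ : Fin n → Fin n, Q.value v = colouringValue v Finset.univ κ := by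
  classical
  have hne : ∀ i, (Q.part i).Nonempty := fun i => ⟨i, Q.mem_part (Finset.mem_univ i)⟩
  have hk : ∀ i, (Q.part i).min' (hne i) ∈ Q.part i := fun i => Finset.min'_mem _ _
  refine ⟨fun i => (Q.part i).min' (hne i), ?_⟩
  have hpart : ∀ i j, (Q.part j).min' (hne j) = (Q.part i).min' (hne i) ↔ j ∈ Q.part i := by
    intro i j
    constructor
    · intro h
      have h₁ := hk j
      rw [h] at h₁
      have h₂ := hk i
      have := (Q.mem_part_iff_part_eq_part (Finset.mem_univ _) (Finset.mem_univ _)).1 h₁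
      have := (Q.mem_part_iff_part_eq_part (Finset.mem_univ _) (Finset.mem_univ _)).1 h₂
      rw [← this, ‹Q.part _ = Q.part j›]
      exact Q.mem_part (Finset.mem_univ j)
    · intro h
      have := (Q.mem_part_iff_part_eq_part (Finset.mem_univ _) (Finset.mem_univ _)).1 h
      simp only [this]
  rw [colouringValue_eq_sum_image h₀, CoalitionStructure.value]
  refine Finset.sum_congr ?_ fun _ _ => rfl
  ext C
  rw [Finset.mem_image]
  constructor
  · intro hC
    obtain ⟨i, hi⟩ := Q.nonempty_of_mem_parts hC
    refine ⟨i, Finset.mem_univ i, ?_⟩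
    rw [← Q.part_eq_of_mem hC hi]
    ext j
    simp [hpart]
  · rintro ⟨i, -, rfl⟩
    rw [show (Finset.univ.filter fun j => (Q.part j).min' (hne j) = (Q.part i).min' (hne i)) =
      Q.part i by ext j; simp [hpart]]
    exact Q.part_mem.2 (Finset.mem_univ i)

/-- The nonempty colour classes of a colouring of all vertices. -/
def colourClasses {n : ℕ} (r : List (Fin n × Fin n)) : List (List (Fin n)) :=
  ((List.finRange n).map fun c => colourClass c r).filter (· ≠ [])

theorem exists_coalitionStructure {n : ℕ} {v : Finset (Fin n) → ℝ} (h₀ : v ∅ = 0)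
    {r : List (Fin n × Fin n)} (hr : (r.map Prod.fst).Perm (List.finRange n)) :
    ∃ P : CoalitionStructure n,
      ListsCoalitions (.ofList ((colourClasses r).map Val.ofVertices)) P ∧
      P.value v = listValue v r := by
  classical
  have hnd := hr.nodup_iff.2 (List.nodup_finRange n)
  obtain ⟨κ, hκ⟩ := exists_colouring hnd
  have hmem : ∀ c i, i ∈ colourClass c r ↔ κ i = c := by
    intro c i
    simp only [colourClass, List.mem_map, List.mem_filter, decide_eq_true_eq]
    constructor
    · rintro ⟨p, ⟨hp, rfl⟩, rfl⟩
      exact hκ p hp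
    · rintro rfl
      obtain ⟨p, hp, rfl⟩ := List.mem_map.1 (hr.mem_iff.2 (List.mem_finRange i))
      exact ⟨p, ⟨hp, (hκ p hp).symm⟩, rfl⟩
  have hset : ∀ c, (colourClass c r).toFinset = Finset.univ.filter fun i => κ i = c := by
    intro c
    ext i
    simp [hmem]
  -- The coalitions must be listed without repetition: equal nonempty classes share a vertex, and
  -- its colour identifies both.
  have hLnd : ((colourClasses r).map List.toFinset).Nodup := by
    rw [colourClasses, List.nodup_map_iff_inj_on]
    · intro a ha b hb hab
      simp only [List.mem_filter, List.mem_map, decide_eq_true_eq] at ha hb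
      obtain ⟨⟨c, -, rfl⟩, hc⟩ := ha
      obtain ⟨⟨d, -, rfl⟩, -⟩ := hb
      obtain ⟨i, hi⟩ := List.exists_mem_of_ne_nil _ hc
      have hi' : i ∈ colourClass d r := by
        rw [← List.mem_toFinset, ← hab, List.mem_toFinset]
        exact hi
      rw [hmem] at hi hi'
      rw [← hi, ← hi']
    · rw [List.filter_map, List.nodup_map_iff_inj_on ((List.nodup_finRange n).filter _)]
      intro c hc d _ hcd
      have hc : colourClass c r ≠ [] := by simpa using (List.mem_filter.1 hc).2
      obtain ⟨i, hi⟩ := List.exists_mem_of_ne_nil _ hc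
      have hi' := hi
      rw [hcd] at hi'
      rw [hmem] at hi hi'
      rw [← hi, ← hi']
  have hLmem : ∀ C, C ∈ (colourClasses r).map List.toFinset ↔
      ∃ i, Finset.univ.filter (fun j => κ j = κ i) = C := by
    intro C
    simp only [colourClasses, List.mem_map, List.mem_filter, decide_eq_true_eq]
    constructor
    · rintro ⟨_, ⟨⟨c, -, rfl⟩, hc⟩, rfl⟩
      obtain ⟨i, hi⟩ := List.exists_mem_of_ne_nil _ hc
      refine ⟨i, ?_⟩
      rw [hset, (hmem c i).1 hi]
    · rintro ⟨i, rfl⟩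
      refine ⟨_, ⟨⟨κ i, List.mem_finRange _, rfl⟩, ?_⟩, hset _⟩
      exact List.ne_nil_of_mem ((hmem _ i).2 rfl)
  let P : CoalitionStructure n := Finpartition.ofSetoid (Setoid.ker κ)
  have hP : P.parts = Finset.univ.image fun i => Finset.univ.filter fun j => κ j = κ i := by
    change Finset.univ.image _ = _
    congr 1
    funext i
    ext j
    simp [eq_comm]
  refine ⟨P, ⟨colourClasses r, rfl, ?_⟩, ?_⟩
  · refine (Multiset.Nodup.ext (Multiset.coe_nodup.2 hLnd) P.parts.nodup).2 fun C => ?_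
    rw [Finset.mem_val, hP, Multiset.mem_coe, hLmem]
    simp
  · rw [listValue_eq_colouringValue hκ, colouringValue_eq_sum_image h₀, CoalitionStructure.value,
      hP]
    congr 1
    have : (r.map Prod.fst).toFinset = Finset.univ := by
      ext i
      simp only [List.mem_toFinset, hr.mem_iff, List.mem_finRange, Finset.mem_univ]
    rw [this]

/-! ### The recursive algorithm -/

namespace Prog

/-- The step of the search for the best extension: the candidate that extends the colouring `ξ`
of the separator by optimal colourings of both sides is compared with the best candidate so far.
The environment is `(((G, V), W, σ), W₁, W₂)`. -/
def improve : Prog :=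
  .letIn (.letIn (.pair (.var 1) (.snd (.snd (.fst (.var 0))))) append)
  -- Index `0` is the function of the enclosing fold, so `call 1` is the recursive function of
  -- `solveBody`.
  (.letIn (.call 1 (.pair (.fst (.fst (.var 1))) (.pair (.fst (.snd (.var 1))) (.var 0))))
  (.letIn (.call 1 (.pair (.fst (.fst (.var 2))) (.pair (.snd (.snd (.var 2))) (.var 1))))
  (.letIn (.letIn (.pair (.var 4) (.letIn (.pair (.var 1) (.var 0)) append)) append)
  (.ite (.var 6)
    (.ite (.bin .le
        (.letIn (.pair (.snd (.fst (.fst (.var 4))))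
          (.letIn (.pair (.var 0) (.snd (.snd (.fst (.var 4))))) append)) value)
        (.letIn (.pair (.snd (.fst (.fst (.var 4))))
          (.letIn (.pair (.var 6) (.snd (.snd (.fst (.var 4))))) append)) value))
      (.var 6) (.var 0))
    (.var 0)))))

/-- The body of the recursive function that colours the vertices in `W`, extending the colouring
`σ`, with the program `q` for separators; the argument is `((G, V), W, σ)`. -/
def solveBody (q : Prog) : Prog :=
  .ite (.fst (.snd (.var 0)))
    (.letIn (.letIn (.fst (.snd (.var 0))) indices)
    (.letIn (.letIn (.letIn (.pair (.fst (.fst (.var 1))) (.pair (.fst (.snd (.var 1))) (.var 0)))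
      subgraph) q)
    (.letIn (.letIn (.pair (.var 0) (.pair (.fst (.snd (.var 2))) (.var 1))) (select true))
    (.letIn (.letIn (.pair (.var 1) (.pair (.fst (.snd (.var 3))) (.var 2))) (select false))
    (.letIn (.letIn (.pair (.pair (.snd (.var 2)) (.fst (.var 2)))
      (.pair (.fst (.snd (.var 4))) (.var 3))) (select false))
    (.letIn (.letIn (.pair (.var 2) (.snd (.snd (.var 5)))) extensions)
    (fold improve (.lit 0) (.pair (.var 6) (.pair (.var 2) (.var 1))) (.var 0)))))))) (.lit 0)

end Prog

section

variable {n : ℕ}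

open Classical in
/-- The best of the candidate colourings, relative to the colouring `σ`. -/
noncomputable def bestColouring (v : Finset (Fin n) → ℝ) (σ : List (Fin n × Fin n)) :
    List (List (Fin n × Fin n)) → List (Fin n × Fin n)
  | [] => []
  | c :: L => if bestColouring v σ L = [] then c else
      if listValue v (c ++ σ) ≤ listValue v (bestColouring v σ L ++ σ) then bestColouring v σ L else c

/-- The empty list stands for "no candidate yet", so it must not occur among the candidates. -/
theorem bestColouring_spec (v : Finset (Fin n) → ℝ) (σ : List (Fin n × Fin n))
    {L : List (List (Fin n × Fin n))} (hL : L ≠ []) (h : [] ∉ L) :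
    bestColouring v σ L ∈ L ∧
      ∀ c ∈ L, listValue v (c ++ σ) ≤ listValue v (bestColouring v σ L ++ σ) := by
  induction L with
  | nil => exact absurd rfl hL
  | cons c L ih =>
    simp only [List.mem_cons, not_or] at h
    rw [bestColouring]
    by_cases hL' : L = []
    · subst hL'
      simp [bestColouring]
    obtain ⟨ih₁, ih₂⟩ := ih hL' h.2
    rw [if_neg fun hb : bestColouring v σ L = [] => h.2 (hb ▸ ih₁)]
    split_ifs with hle
    · refine ⟨List.mem_cons_of_mem _ ih₁, fun d hd => ?_⟩
      rcases List.mem_cons.1 hd with rfl | hd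
      · exact hle
      · exact ih₂ d hd
    · refine ⟨List.mem_cons_self, fun d hd => ?_⟩
      rcases List.mem_cons.1 hd with rfl | hd
      · exact le_rfl
      · exact (ih₂ d hd).trans (not_le.1 hle).le

theorem bestColouring_length_le {v : Finset (Fin n) → ℝ} {σ : List (Fin n × Fin n)}
    {L : List (List (Fin n × Fin n))} {k : ℕ} (h : ∀ c ∈ L, c.length ≤ k) :
    (bestColouring v σ L).length ≤ k := by
  induction L with
  | nil => simp [bestColouring]
  | cons c L ih =>
    have h₁ := h c List.mem_cons_self
    have h₂ := ih fun d hd => h d (List.mem_cons_of_mem _ hd)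
    rw [bestColouring]
    split_ifs <;> assumption

theorem colourings_ne_nil (σ : List (Fin n × Fin n)) (X : List (Fin n)) : colourings σ X ≠ [] := by
  induction X with
  | nil => simp [colourings]
  | cons x X ih =>
    obtain ⟨ξ, hξ⟩ := List.exists_mem_of_ne_nil _ ih
    refine List.ne_nil_of_mem (a := (x, x) :: ξ) ?_
    simp only [colourings, recolourings, List.mem_flatMap, List.mem_append (t := [_])]
    exact ⟨ξ, hξ, Or.inr (List.mem_singleton_self _)⟩

/-- The argument of the recursive function. -/
noncomputable def solveArg (G : SimpleGraph (Fin n)) (W : List (Fin n))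
    (σ : List (Fin n × Fin n)) : Val :=
  .pair (.pair (encodeGraph G) (.ofVertices (List.finRange n))) (.pair (.ofVertices W) (.ofPairs σ))

variable {G : SimpleGraph (Fin n)} {v : Finset (Fin n) → ℝ} {q : Prog} {Z : ℕ}

/-- Apart from the two recursive calls, the work consists of concatenations and two evaluations of
colourings, which `Z ^ 5` covers. -/
theorem evalIn_improve (h₀ : v ∅ = 0) (hZ : 1000 ≤ Z) (hn : n ≤ Z) {Γ : List Prog} {g : Prog}
    {W W₁ W₂ : List (Fin n)} {σ ξ τ₁ τ₂ r : List (Fin n × Fin n)} {T : ℕ}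
    (hcand : (ξ ++ (τ₁ ++ τ₂) ++ σ).length ≤ Z) (hr : (r ++ σ).length ≤ Z)
    (h₁ : EvalIn (valuationOracle v) (g :: Γ) [solveArg G W₁ (ξ ++ σ)] g (.ofPairs τ₁) T)
    (h₂ : EvalIn (valuationOracle v) (g :: Γ) [solveArg G W₂ (ξ ++ σ)] g (.ofPairs τ₂) T)
    (f : Prog) :
    EvalIn (valuationOracle v) (f :: g :: Γ)
      [.pair (solveArg G W σ) (.pair (.ofVertices W₁) (.ofVertices W₂)), .ofPairs ξ, .ofPairs r]
      .improve (.ofPairs (open Classical in if r = [] then ξ ++ (τ₁ ++ τ₂) else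
        if listValue v (ξ ++ (τ₁ ++ τ₂) ++ σ) ≤ listValue v (r ++ σ) then r
          else ξ ++ (τ₁ ++ τ₂))) (Z ^ 5 + 2 * T) := by
  classical
  simp only [List.length_append] at hcand hr
  refine EvalIn.mono
    (EvalIn.letIn (EvalIn.app (EvalIn.of_path rfl) (evalIn_append (l₁ := ξ) (l₂ := σ) hZ (by omega)))
    (EvalIn.letIn (EvalIn.call (EvalIn.of_path rfl) rfl h₁)
    (EvalIn.letIn (EvalIn.call (EvalIn.of_path rfl) rfl h₂)
    (EvalIn.letIn (EvalIn.app (EvalIn.pair (EvalIn.of_path rfl) (EvalIn.app (EvalIn.of_path rfl)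
      (evalIn_append (l₁ := τ₁) (l₂ := τ₂) hZ (by omega))))
      (evalIn_append (l₁ := ξ) (l₂ := τ₁ ++ τ₂) hZ (by omega)))
      (t := 3 * Z ^ 4) ?_)))) ?_
  · by_cases hnil : r = []
    · subst hnil
      rw [if_pos rfl]
      refine EvalIn.mono (EvalIn.iteFalse (EvalIn.of_path rfl) (EvalIn.of_path rfl)) ?_
      have h₂ := mul_pow_le_pow_succ hZ 1
      have h₃ := mul_pow_le_pow_succ hZ 2
      have h₄ := mul_pow_le_pow_succ hZ 3
      simp only [Nat.reduceAdd, pow_one] at h₂ h₃ h₄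
      omega
    · rw [if_neg hnil]
      obtain ⟨p, r', hpr⟩ := List.exists_cons_of_ne_nil hnil
      refine EvalIn.mono (EvalIn.iteTrue (EvalIn.of_path rfl) (x := .ofPairs r) ?_ (EvalIn.congr
        (EvalIn.ite_prop
          (p := listValue v (ξ ++ (τ₁ ++ τ₂) ++ σ) ≤ listValue v (r ++ σ))
          (EvalIn.bin (EvalIn.app (EvalIn.pair (EvalIn.of_path rfl) (EvalIn.app (EvalIn.of_path rfl)
              (evalIn_append (l₁ := ξ ++ (τ₁ ++ τ₂)) (l₂ := σ) hZ
                (by simp only [List.length_append]; omega))))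
              (evalIn_value h₀ hZ hn (by simp only [List.length_append]; omega)))
            (EvalIn.app (EvalIn.pair (EvalIn.of_path rfl) (EvalIn.app (EvalIn.of_path rfl)
              (evalIn_append (l₁ := r) (l₂ := σ) hZ (by omega))))
              (evalIn_value h₀ hZ hn (by simp only [List.length_append]; omega))) ?_)
          (fun _ => EvalIn.of_path rfl) (fun _ => EvalIn.of_path rfl)) (apply_ite _ _ _ _).symm)) ?_
      · rw [hpr]
        simp [Val.ofPairs, Val.ofList]
      · simp only [BinOp.app]
      · have h₂ := mul_pow_le_pow_succ hZ 1
        have h₃ := mul_pow_le_pow_succ hZ 2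
        have h₄ := mul_pow_le_pow_succ hZ 3
        simp only [Nat.reduceAdd, pow_one] at h₂ h₃ h₄
        omega
  · have h₂ := mul_pow_le_pow_succ hZ 1
    have h₃ := mul_pow_le_pow_succ hZ 2
    have h₄ := mul_pow_le_pow_succ hZ 3
    have h₅ := mul_pow_le_pow_succ hZ 4
    simp only [Nat.reduceAdd, pow_one] at h₂ h₃ h₄ h₅
    omega

/-- On the subgraph of `G` induced by any nonempty list of vertices, the program `q` finds within
`s` steps a separator of at most `F` vertices, with at most a `β`-fraction on each side. -/
def SeparatesInduced (G : SimpleGraph (Fin n)) (q : Prog) (β : ℝ) (F s : ℕ) : Prop :=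
  ∀ W : List (Fin n), W.Nodup → W ≠ [] → ∃ (a b : List (Fin W.length)) (t : ℕ), t ≤ s ∧
    Runs noOracle q (encodeGraph (G.comap W.get)) (.pair (.ofVertices a) (.ofVertices b)) t ∧
    (∀ j, j ∈ a ∨ j ∈ b) ∧
    ((List.finRange W.length).filter fun j => j ∈ a ∧ j ∈ b).length ≤ F ∧
    (((List.finRange W.length).filter fun j => j ∈ a ∧ j ∉ b).length : ℝ) ≤ β * W.length ∧
    (((List.finRange W.length).filter fun j => j ∈ b ∧ j ∉ a).length : ℝ) ≤ β * W.length ∧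
    ∀ i j, i ∈ a → i ∉ b → j ∈ b → j ∉ a → ¬ G.Adj (W.get i) (W.get j)

theorem perm_select {W : List (Fin n)} {a b : List (Fin W.length)} (hab : ∀ j, j ∈ a ∨ j ∈ b) :
    W.Perm (((List.finRange W.length).filter fun j => j ∈ a ∧ j ∈ b).map W.get ++
      (((List.finRange W.length).filter fun j => j ∈ a ∧ j ∉ b).map W.get ++
        ((List.finRange W.length).filter fun j => j ∈ b ∧ j ∉ a).map W.get)) := by
  conv_lhs => rw [← List.map_get_finRange W]
  rw [← List.map_append, ← List.map_append]
  refine List.Perm.map _ ?_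
  have h := List.nodup_finRange W.length
  refine (List.perm_ext_iff_of_nodup h ?_).2 fun j => ?_
  · refine List.nodup_append.2 ⟨h.filter _, List.nodup_append.2 ⟨h.filter _, h.filter _, ?_⟩, ?_⟩
    · intro i hi j hj
      simp only [List.mem_filter, decide_eq_true_eq] at hi hj
      rintro rfl
      exact hi.2.2 hj.2.1
    · intro i hi j hj
      simp only [List.mem_append, List.mem_filter, decide_eq_true_eq] at hi hj
      rintro rfl
      tauto
  · have := hab j
    simp only [List.mem_append, List.mem_filter, decide_eq_true_eq, List.mem_finRange, true_and]
    tauto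

/-- The recursion finds an optimal colouring. -/
theorem exists_evalIn_solveBody (hv : IsIDM G v) (h₀ : v ∅ = 0) {β : ℝ} (hβ : 0 ≤ β) {F s : ℕ}
    (hq : SeparatesInduced G q β F s) (hZ : 1000 + 2 * n + s ≤ Z) (m j : ℕ)
    (W : List (Fin n)) (σ : List (Fin n × Fin n)) (hnd : (W ++ σ.map Prod.fst).Nodup)
    (hσ : ∀ p ∈ σ, p.2 ∈ σ.map Prod.fst) (hW : β ^ j * W.length < 1)
    (hm : σ.length + F * j ≤ m) (hm' : 1 ≤ m) :
    ∃ τ, EvalIn (valuationOracle v) [.solveBody q] [solveArg G W σ] (.solveBody q) (.ofPairs τ)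
      (Z ^ 7 * (4 * m ^ F) ^ j) ∧ IsOptimal v W σ τ := by
  -- Here `j` counts the remaining levels and `m` is a fixed budget of coloured vertices. A level
  -- moves at most `F` vertices from `W` to `σ`, which preserves `σ.length + F * j ≤ m`.
  induction j generalizing W σ with
  | zero =>
    have hWn : W = [] := by
      rw [pow_zero, one_mul] at hW
      exact List.length_eq_zero_iff.1 (by exact_mod_cast Nat.lt_one_iff.1 (by exact_mod_cast hW))
    subst hWn
    refine ⟨[], EvalIn.mono (EvalIn.iteFalse (EvalIn.of_path rfl) (EvalIn.of_path rfl)) ?_,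
      .nil h₀ (by simpa using hnd)⟩
    have := Nat.pow_le_pow_left (show 1000 ≤ Z by omega) 7
    rw [pow_zero, mul_one]
    omega
  | succ j ih =>
    classical
    have hZ' : 1000 ≤ Z := by omega
    set M := m ^ F with hM
    have hM1 : 1 ≤ M := Nat.one_le_pow _ _ hm'
    have hp1 := mul_pow_le_pow_succ hZ' 1
    have hp2 := mul_pow_le_pow_succ hZ' 2
    have hp3 := mul_pow_le_pow_succ hZ' 3
    have hp4 := mul_pow_le_pow_succ hZ' 4
    have hp5 := mul_pow_le_pow_succ hZ' 5
    have hp6 := mul_pow_le_pow_succ hZ' 6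
    simp only [Nat.reduceAdd, pow_one] at hp1 hp2 hp3 hp4 hp5 hp6
    set T := Z ^ 7 * (4 * M) ^ j with hT
    have hT7 : Z ^ 7 ≤ T := Nat.le_mul_of_pos_right _ (by positivity)
    have hTM : T ≤ T * M := Nat.le_mul_of_pos_right _ (by positivity)
    -- At most `M` candidates with two recursive calls each cost `2 * (T * M)`; the other half of `4
    -- * (T * M)` absorbs everything else.
    have hTsucc : Z ^ 7 * (4 * M) ^ (j + 1) = 4 * (T * M) := by rw [pow_succ, hT]; ring
    rw [hTsucc]
    by_cases hWn : W = []
    · subst hWn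
      refine ⟨[], EvalIn.mono (EvalIn.iteFalse (EvalIn.of_path rfl) (EvalIn.of_path rfl)) ?_,
        .nil h₀ (by simpa using hnd)⟩
      omega
    obtain ⟨a, b, t, hts, hrun, hab, hX, hW₁, hW₂, hadj⟩ :=
      hq W (List.nodup_append.1 hnd).1 hWn
    set X := ((List.finRange W.length).filter fun j => j ∈ a ∧ j ∈ b).map W.get with hXdef
    set W₁ := ((List.finRange W.length).filter fun j => j ∈ a ∧ j ∉ b).map W.get with hW₁def
    set W₂ := ((List.finRange W.length).filter fun j => j ∈ b ∧ j ∉ a).map W.get with hW₂def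
    have hperm : W.Perm (X ++ (W₁ ++ W₂)) := perm_select hab
    have hXl : X.length ≤ F := by simpa [hXdef] using hX
    have hnd' : (X ++ (W₁ ++ W₂) ++ σ.map Prod.fst).Nodup :=
      (hperm.append_right _).nodup_iff.1 hnd
    have hlen : W.length + σ.length ≤ n := by simpa using hnd.length_le_card
    have hlen' : X.length + W₁.length + W₂.length + σ.length ≤ n := by
      have := hperm.length_eq
      simp only [List.length_append] at this
      omega
    -- Repetitions in the output are not excluded, so its length is bounded through the running
    -- time.
    have hab_len : a.length ≤ Z ∧ b.length ≤ Z := by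
      have h₁ := Eval.spine_le hrun (2 * W.length) (by
        intro x hx
        rw [List.mem_singleton.1 hx]
        exact spine_encodeGraph_le _)
      have h₂ := Val.length_le_spine_ofVertices a
      have h₃ := Val.length_le_spine_ofVertices b
      simp only [Val.spine] at h₁
      omega
    have hsmall : ∀ {W' : List (Fin n)}, (W'.length : ℝ) ≤ β * W.length →
        β ^ j * W'.length < 1 := fun {W'} h => by
      refine lt_of_le_of_lt ?_ hW
      rw [pow_succ, mul_assoc]
      exact mul_le_mul_of_nonneg_left h (pow_nonneg hβ _)
    have hrec : ∀ W', (W' = W₁ ∨ W' = W₂) → ∀ ξ ∈ colourings σ X, ∃ τ,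
        EvalIn (valuationOracle v) [.solveBody q] [solveArg G W' (ξ ++ σ)] (.solveBody q)
          (.ofPairs τ) T ∧ IsOptimal v W' (ξ ++ σ) τ := by
      intro W' hW' ξ hξ
      have hk := map_fst_of_mem_colourings hξ
      have hkl : ξ.length = X.length := by simpa using congrArg List.length hk
      refine ih W' (ξ ++ σ) ?_ (colours_subset_of_mem_colourings hσ hξ) ?_ ?_
      · rw [List.map_append, hk, ← List.append_assoc]
        refine (List.Perm.append_right _ List.perm_append_comm).nodup_iff.1 (hnd'.sublist ?_)
        rcases hW' with rfl | rfl <;> simp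
      · rcases hW' with rfl | rfl
        · exact hsmall (by simpa [hW₁def] using hW₁)
        · exact hsmall (by simpa [hW₂def] using hW₂)
      · rw [List.length_append]
        rw [Nat.mul_succ] at hm
        omega
    -- The default `[]` outside the list of colourings makes the solutions total functions of `ξ`.
    have hτ₁ : ∀ ξ, ∃ τ, ξ ∈ colourings σ X →
        EvalIn (valuationOracle v) [.solveBody q] [solveArg G W₁ (ξ ++ σ)] (.solveBody q)
          (.ofPairs τ) T ∧ IsOptimal v W₁ (ξ ++ σ) τ := fun ξ => by
      by_cases hξ : ξ ∈ colourings σ X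
      · exact (hrec W₁ (Or.inl rfl) ξ hξ).imp fun τ h _ => h
      · exact ⟨[], fun h => absurd h hξ⟩
    have hτ₂ : ∀ ξ, ∃ τ, ξ ∈ colourings σ X →
        EvalIn (valuationOracle v) [.solveBody q] [solveArg G W₂ (ξ ++ σ)] (.solveBody q)
          (.ofPairs τ) T ∧ IsOptimal v W₂ (ξ ++ σ) τ := fun ξ => by
      by_cases hξ : ξ ∈ colourings σ X
      · exact (hrec W₂ (Or.inr rfl) ξ hξ).imp fun τ h _ => h
      · exact ⟨[], fun h => absurd h hξ⟩
    choose τ₁ hτ₁ using hτ₁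
    choose τ₂ hτ₂ using hτ₂
    set cand : List (Fin n × Fin n) → List (Fin n × Fin n) := fun ξ => ξ ++ (τ₁ ξ ++ τ₂ ξ)
      with hcand
    have hcand_len : ∀ ξ ∈ colourings σ X, (cand ξ).length = W.length := by
      intro ξ hξ
      have e₁ := congrArg List.length (map_fst_of_mem_colourings hξ)
      have e₂ := (hτ₁ ξ hξ).2.perm.length_eq
      have e₃ := (hτ₂ ξ hξ).2.perm.length_eq
      have e₄ := hperm.length_eq
      simp only [List.length_append, List.length_map, hcand] at *
      omega
    -- Every candidate has the length of the nonempty list `W`, so none is the sentinel `[]`.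
    have hbest := bestColouring_spec v σ (L := (colourings σ X).map cand)
      (by simpa using colourings_ne_nil σ X) (by
        intro h
        obtain ⟨ξ, hξ, h⟩ := List.mem_map.1 h
        have := hcand_len ξ hξ
        rw [h] at this
        exact hWn (List.length_eq_zero_iff.1 this.symm))
    refine ⟨bestColouring v σ ((colourings σ X).map cand), ?_, ?_⟩
    · have hsX := evalIn_select (O := valuationOracle v) true (W := W)
        (J := List.finRange W.length) hZ' hab_len.1 hab_len.2 (by omega) (by simp; omega)
      have hs₁ := evalIn_select (O := valuationOracle v) false (W := W)
        (J := List.finRange W.length) hZ' hab_len.1 hab_len.2 (by omega) (by simp; omega)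
      have hs₂ := evalIn_select (O := valuationOracle v) false (W := W)
        (J := List.finRange W.length) hZ' hab_len.2 hab_len.1 (by omega) (by simp; omega)
      simp only [iff_true, Bool.false_eq_true, iff_false] at hsX hs₁ hs₂
      rw [← hXdef] at hsX
      rw [← hW₁def] at hs₁
      rw [← hW₂def] at hs₂
      have hM' : ∀ X', X' <:+ X → (colourings σ X').length ≤ M := fun X' hX' => by
        have hl := hX'.length_le
        refine (length_colourings_le σ X' m ?_).trans (Nat.pow_le_pow_right hm' (hl.trans hXl))
        rw [Nat.mul_succ] at hm
        omega
      -- The absent oracle answers nothing, so a run with it remains valid with any oracle.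
      have hrun' : EvalIn (valuationOracle v) [] [encodeGraph (G.comap W.get)] q
          (.pair (.ofVertices a) (.ofVertices b)) Z :=
        ⟨t, by omega, by simpa using Eval.weaken (fun _ _ h => by cases h) hrun [] []⟩
      refine EvalIn.mono (EvalIn.iteTrue (EvalIn.of_path rfl) (x := .ofVertices W) ?_
        (EvalIn.letIn (EvalIn.app (EvalIn.of_path rfl)
          (evalIn_indices_ofVertices (W := W) hZ' (by omega)))
        (EvalIn.letIn (EvalIn.app (EvalIn.app (EvalIn.of_path rfl)
          (evalIn_subgraph (W := W) (G := G) hZ' (by omega) (by omega))) hrun')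
        (EvalIn.letIn (EvalIn.app (EvalIn.of_path rfl) hsX)
        (EvalIn.letIn (EvalIn.app (EvalIn.of_path rfl) hs₁)
        (EvalIn.letIn (EvalIn.app (EvalIn.of_path rfl) hs₂)
        (EvalIn.letIn (EvalIn.app (EvalIn.of_path rfl)
          (evalIn_extensions (X := X) (σ := σ) hZ' (by omega) (by omega) hM'))
        (evalIn_fold (enc := Val.ofPairs) (l := colourings σ X)
          (R := fun L => .ofPairs (bestColouring v σ (L.map cand))) (c := Z ^ 5 + 2 * T)
          (env := .pair (solveArg G W σ) (.pair (.ofVertices W₁) (.ofVertices W₂)))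
          (EvalIn.of_path rfl) (EvalIn.of_path rfl) EvalIn.lit
          (fun ξ L hL => ?_))))))))) ?_
      · obtain ⟨x, W', hx⟩ := List.exists_cons_of_ne_nil hWn
        rw [hx, Val.ofVertices_eq]
        simp [Val.ofList]
      · have hξ := hL.subset List.mem_cons_self
        refine (evalIn_improve h₀ hZ' (by omega) ?_ ?_ (hτ₁ ξ hξ).1 (hτ₂ ξ hξ).1 _).congr ?_
        · have := hcand_len ξ hξ
          simp only [hcand] at this
          rw [List.length_append, this]
          omega
        · rw [List.length_append]
          have : (bestColouring v σ (L.map cand)).length ≤ W.length := by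
            refine bestColouring_length_le fun c hc => ?_
            obtain ⟨ξ', hξ', rfl⟩ := List.mem_map.1 hc
            exact (hcand_len ξ' (hL.subset (List.mem_cons_of_mem _ hξ'))).le
          omega
        · rw [List.map_cons, bestColouring]
      · have h₁ := Nat.mul_le_mul_right (Z ^ 5 + 2 * T + 100) (hM' X List.suffix_rfl)
        have h₂ : M * (Z ^ 5 + 2 * T + 100) = Z ^ 5 * M + 2 * (T * M) + 100 * M := by ring
        have h₃ := Nat.mul_le_mul_right M hp5
        have h₄ := Nat.mul_le_mul_right M hp6
        have h₅ := Nat.mul_le_mul_right M hT7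
        have h₆ := Nat.mul_le_mul_right M (show 1000 ≤ Z ^ 5 by omega)
        rw [mul_assoc] at h₃ h₄
        omega
    · refine hv.isOptimal h₀ hperm hnd hσ ?_ (fun ξ hξ => (hτ₁ ξ hξ).2)
        (fun ξ hξ => (hτ₂ ξ hξ).2) ?_ fun ξ hξ => hbest.2 _ (List.mem_map_of_mem hξ)
      · intro i hi k hk
        simp only [hW₁def, hW₂def, List.mem_map, List.mem_filter, decide_eq_true_eq] at hi hk
        obtain ⟨i, ⟨-, hi⟩, rfl⟩ := hi
        obtain ⟨k, ⟨-, hk⟩, rfl⟩ := hk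
        exact hadj i k hi.1 hi.2 hk.1 hk.2
      · obtain ⟨ξ, hξ, h⟩ := List.mem_map.1 hbest.1
        exact ⟨ξ, hξ, h.symm⟩

end

/-- The program for the graph coalition structure generation problem, from a program `q` for
separators. -/
def Prog.solve (q : Prog) : Prog :=
  .letRec (solveBody q)
    (.letIn (.letIn (.var 0) indices)
    (.letIn (.call 0 (.pair (.pair (.var 1) (.var 0)) (.pair (.var 0) (.lit 0))))
    (.letIn (.pair (.var 1) (.var 0)) classes)))

/-- The recursion starts with no coloured vertices and the budget `F * D` for `D` levels. The extra
factor `Z` pays for listing the vertices and for converting the colouring into coalitions. -/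
theorem exists_runs_solve {n : ℕ} {G : SimpleGraph (Fin n)} {v : Finset (Fin n) → ℝ} {q : Prog}
    (hv : IsIDM G v) (h₀ : v ∅ = 0) {β : ℝ} (hβ : 0 ≤ β) {F s : ℕ} (hF : 1 ≤ F)
    (hq : SeparatesInduced G q β F s) {D : ℕ} (hD : 1 ≤ D) (hβD : β ^ D * n < 1) :
    ∃ (y : Val) (t : ℕ) (P : CoalitionStructure n),
      Runs (valuationOracle v) (.solve q) (encodeGraph G) y t ∧
      t ≤ (1000 + 2 * n + s) ^ 8 * (4 * (F * D) ^ F) ^ D ∧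
      ListsCoalitions y P ∧ ∀ Q : CoalitionStructure n, Q.value v ≤ P.value v := by
  set Z := 1000 + 2 * n + s with hZdef
  have hZ : 1000 ≤ Z := by omega
  have hm : 1 ≤ F * D := Nat.mul_pos hF hD
  obtain ⟨τ, hτ, hopt⟩ := exists_evalIn_solveBody hv h₀ hβ hq (Z := Z) le_rfl (F * D) D
    (List.finRange n) [] (by simpa using List.nodup_finRange n) (by simp) (by simpa using hβD)
    (by simp) hm
  obtain ⟨P, hP, hPv⟩ := exists_coalitionStructure h₀ hopt.perm
  have hlen : τ.length = n := by simpa using hopt.perm.length_eq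
  set B := (4 * (F * D) ^ F) ^ D with hB
  have hB1 : 1 ≤ B := Nat.one_le_pow _ _ (by positivity)
  have hind : EvalIn (valuationOracle v) [] [encodeGraph G] .indices
      (.ofVertices (List.finRange n)) (Z ^ 2) := by
    rw [Val.ofVertices, List.map_coe_finRange_eq_range]
    exact (evalIn_indices (l := (List.finRange n).map _) hZ (by simp; omega)).congr
      (by rw [List.length_map, List.length_finRange])
  have hrun : EvalIn (valuationOracle v) [] [encodeGraph G] (.solve q)
      (.ofList ((colourClasses τ).map Val.ofVertices)) (Z ^ 8 * B) := by
    refine EvalIn.mono (EvalIn.letRec (EvalIn.letIn (EvalIn.app (EvalIn.of_path rfl) hind)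
      (EvalIn.letIn (EvalIn.call (x := solveArg G (List.finRange n) []) (EvalIn.of_path rfl) rfl hτ)
      (EvalIn.app (EvalIn.of_path rfl) (evalIn_classes hZ (by omega) (by omega)))))) ?_
    have hp1 := mul_pow_le_pow_succ hZ 1
    have hp2 := mul_pow_le_pow_succ hZ 2
    have hp3 := mul_pow_le_pow_succ hZ 3
    have hp4 := mul_pow_le_pow_succ hZ 4
    have hp5 := mul_pow_le_pow_succ hZ 5
    have hp6 := mul_pow_le_pow_succ hZ 6
    have hp7 := Nat.mul_le_mul_right B (mul_pow_le_pow_succ hZ 7)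
    have hp8 := Nat.mul_le_mul_left (Z ^ 7) hB1
    simp only [Nat.reduceAdd, pow_one, mul_assoc] at hp1 hp2 hp3 hp4 hp5 hp6 hp7 hp8
    omega
  obtain ⟨t, ht, hrun⟩ := hrun
  refine ⟨_, t, P, hrun, ht, hP, fun Q => ?_⟩
  -- Agreement with the empty list is vacuous, so optimality covers every coalition structure.
  obtain ⟨κ, hκ⟩ := Q.exists_value_eq h₀
  rw [hκ, hPv]
  have := hopt.le κ (by intro p hp; cases hp)
  simpa using this

/-! ### The size of the bound -/

/-- The bound after taking logarithms: `x = c log n`, `φ = f n`, `ν = μ (f n)` and `y = log (x φ)`.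
The dominant term on the left is `x * φ * y`, against `2 * x * φ * y` on the right. The thresholds
`128`, `24` and `32` keep the terms without `ν` below `(1/4 + 1/8 + 81/64) * (x * φ * y)`, and the
`ν` terms are compared separately. -/
theorem separator_step_bound {x φ ν y c C L : ℝ} (hc : 0 < c) (hx : x = c * L) (hx1 : 128 ≤ x)
    (hφ : 1 ≤ φ) (hν : 0 ≤ ν) (hy : 24 ≤ y) (hy' : 32 * (C + 1 / c) ≤ y) (hC : 0 ≤ C)
    (hlog : Real.log φ ≤ y) :
    8 * (C + L + 2 * ν * Real.log 2 + 2 * φ * Real.log φ) + (x + 1) * (2 + φ * (1 + y)) ≤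
      2 * Real.log 2 * x * ν + 2 * x * φ * y := by
  have hl2 : 0 < Real.log 2 := Real.log_pos (by norm_num)
  have e₁ : 16 * (ν * Real.log 2) ≤ 2 * (x * (ν * Real.log 2)) := by
    have := mul_le_mul_of_nonneg_right hx1 (mul_nonneg hν hl2.le)
    have := mul_nonneg hν hl2.le
    linarith
  have hφy : 0 ≤ φ * y := by positivity
  have hxφy : 128 * (φ * y) ≤ x * (φ * y) := mul_le_mul_of_nonneg_right hx1 hφy
  have e₂ : φ * Real.log φ ≤ φ * y := mul_le_mul_of_nonneg_left hlog (by linarith)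
  have e₃ : (x + 1) * (2 + φ * (1 + y)) ≤ (9 / 8 * x) * (9 / 8 * (φ * y)) := by
    refine mul_le_mul (by linarith) ?_ (by positivity) (by positivity)
    have : φ * 24 ≤ φ * y := mul_le_mul_of_nonneg_left hy (by linarith)
    nlinarith
  have e₄ : C + L ≤ x * (C + 1 / c) := by
    have h₁ : x * (1 / c) = L := by rw [hx]; field_simp
    have h₂ : C ≤ x * C := le_mul_of_one_le_left hC (by linarith)
    rw [mul_add, h₁]
    linarith
  have e₅ : x * (C + 1 / c) ≤ x * (φ * y) / 32 := by
    have h₁ : C + 1 / c ≤ φ * y / 32 := by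
      have : 1 * y ≤ φ * y := mul_le_mul_of_nonneg_right hφ (by linarith)
      linarith
    have := mul_le_mul_of_nonneg_left h₁ (show 0 ≤ x by linarith)
    linarith
  nlinarith

/-- The step count of the algorithm is of the required order. -/
theorem isBigO_steps {f : ℕ → ℝ} {μ : ℝ → ℝ} (hf : ∀ n, 1 ≤ n → 1 ≤ f n)
    (hμ : ∀ n, 1 ≤ n → 0 ≤ μ (f n)) {c K : ℝ} (hc : 0 < c) (hK : 0 ≤ K) :
    (fun n : ℕ => (((1000 + 2 * n + ⌊K * ((2 : ℝ) ^ (2 * μ (f n)) * f n ^ (2 * f n))⌋₊) ^ 8 *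
      (4 * (⌊f n⌋₊ * (⌊c * Real.log n⌋₊ + 1)) ^ ⌊f n⌋₊) ^ (⌊c * Real.log n⌋₊ + 1) : ℕ) : ℝ))
      =O[atTop] fun n : ℕ => (n : ℝ) ^
        (2 * Real.log 2 * c * μ (f n) + 2 * c * f n * Real.log (c * Real.log n * f n)) := by
  have hlog : Tendsto (fun n : ℕ => c * Real.log n) atTop atTop :=
    (Real.tendsto_log_atTop.comp tendsto_natCast_atTop_atTop).const_mul_atTop hc
  set C := Real.log (1002 + K) with hC
  have hC0 : 0 ≤ C := Real.log_nonneg (by linarith)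
  have hy : ∀ᶠ n : ℕ in atTop, max 24 (32 * (C + 1 / c)) ≤ Real.log (c * Real.log n) :=
    (Real.tendsto_log_atTop.comp hlog).eventually_ge_atTop _
  refine IsBigO.of_bound 1 ?_
  filter_upwards [hy, hlog.eventually_ge_atTop 128, eventually_ge_atTop 1] with n hy hx hn
  have hnR : (1 : ℝ) ≤ n := by exact_mod_cast hn
  have hn0 : (0 : ℝ) < n := by linarith
  set φ := f n with hφdef
  have hφ : 1 ≤ φ := hf n hn
  have hφ0 : 0 < φ := by linarith
  set ν := μ φ with hνdef
  have hν : 0 ≤ ν := hμ n hn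
  set L := Real.log n with hL
  set x := c * L with hxdef
  have hx0 : 0 < x := by linarith
  set g := (2 : ℝ) ^ (2 * ν) * φ ^ (2 * φ) with hg
  have hg1 : 1 ≤ g := one_le_mul_of_one_le_of_one_le
    (Real.one_le_rpow (by norm_num) (by linarith)) (Real.one_le_rpow hφ (by linarith))
  have hlogx : Real.log x ≤ Real.log (x * φ) :=
    Real.log_le_log hx0 (le_mul_of_one_le_right hx0.le hφ)
  set F := ⌊φ⌋₊ with hF
  have hF1 : 1 ≤ F := Nat.le_floor (by simpa using hφ)
  have hFφ : (F : ℝ) ≤ φ := Nat.floor_le hφ0.le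
  set D := ⌊x⌋₊ + 1 with hD
  have hDx : (D : ℝ) ≤ x + 1 := by
    rw [hD]
    push_cast
    linarith [Nat.floor_le hx0.le]
  have hD0 : (1 : ℝ) ≤ D := by rw [hD]; push_cast; linarith [Nat.cast_nonneg (α := ℝ) ⌊x⌋₊]
  have hF0 : (1 : ℝ) ≤ F := by exact_mod_cast hF1
  set s := ⌊K * g⌋₊ with hs
  have hsK : (s : ℝ) ≤ K * g := Nat.floor_le (by positivity)
  rw [one_mul, Real.norm_of_nonneg (by positivity), Real.norm_of_nonneg (by positivity)]
  push_cast
  -- Since `n` and `g` are at least `1`, the sum is dominated by a product, whose logarithm splits.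
  have hZ : (1000 + 2 * (n : ℝ) + s) ≤ (1002 + K) * (n * g) := by
    have h₁ : (n : ℝ) ≤ n * g := le_mul_of_one_le_right hn0.le hg1
    have h₂ : g ≤ n * g := le_mul_of_one_le_left (by linarith) hnR
    nlinarith
  have hZ0 : 0 < 1000 + 2 * (n : ℝ) + s := by positivity
  have hlogZ : Real.log (1000 + 2 * (n : ℝ) + s) ≤
      C + L + 2 * ν * Real.log 2 + 2 * φ * Real.log φ := by
    refine (Real.log_le_log hZ0 hZ).trans_eq ?_
    rw [Real.log_mul (by positivity) (by positivity), Real.log_mul (by positivity) (by positivity),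
      hg, Real.log_mul (by positivity) (by positivity), Real.log_rpow (by norm_num),
      Real.log_rpow hφ0]
    ring
  have hlogFD : Real.log (F * D) ≤ 1 + Real.log (x * φ) := by
    have h₁ : (F : ℝ) * D ≤ 2 * (x * φ) := by
      have : (F : ℝ) * D ≤ φ * (x + 1) := mul_le_mul hFφ hDx (by positivity) hφ0.le
      nlinarith
    refine (Real.log_le_log (by positivity) h₁).trans ?_
    rw [Real.log_mul (by norm_num) (by positivity)]
    linarith [Real.log_two_lt_d9]
  have hFDlog : 0 ≤ Real.log (F * D) := Real.log_nonneg (one_le_mul_of_one_le_of_one_le hF0 hD0)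
  have hlog4 : Real.log 4 ≤ 2 := by
    rw [show (4 : ℝ) = 2 ^ 2 by norm_num, Real.log_pow]
    push_cast
    linarith [Real.log_two_lt_d9]
  rw [← Real.log_le_log_iff (by positivity) (by positivity), Real.log_rpow hn0,
    Real.log_mul (by positivity) (by positivity), Real.log_pow, Real.log_pow,
    Real.log_mul (by positivity) (by positivity), Real.log_pow]
  have hmax := max_le_iff.1 hy
  have key := separator_step_bound (C := C) (L := L) (y := Real.log (x * φ)) hc hxdef hx hφ hν
    (hmax.1.trans hlogx) (hmax.2.trans hlogx) hC0
    (Real.log_le_log hφ0 (le_mul_of_one_le_left hφ0.le (by linarith)))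
  have h₁ : (F : ℝ) * Real.log (F * D) ≤ φ * (1 + Real.log (x * φ)) :=
    mul_le_mul hFφ hlogFD hFDlog hφ0.le
  have h₂ : (D : ℝ) * (Real.log 4 + F * Real.log (F * D)) ≤
      (x + 1) * (2 + φ * (1 + Real.log (x * φ))) :=
    mul_le_mul hDx (by linarith)
      (add_nonneg (Real.log_nonneg (by norm_num)) (by positivity)) (by linarith)
  have h₃ : (2 * Real.log 2 * c * ν + 2 * c * φ * Real.log (x * φ)) * L =
      2 * Real.log 2 * x * ν + 2 * x * φ * Real.log (x * φ) := by rw [hxdef]; ring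
  rw [h₃]
  push_cast
  linarith

/-! ### Connected coalition structures -/

/-- Two members of a coalition are joined by a walk inside it, and membership in `Q.part` is passed
along the edges of the walk. -/
theorem CoalitionStructure.IsConnected.mem_part {n : ℕ} {G : SimpleGraph (Fin n)}
    {P Q : CoalitionStructure n} (hP : P.IsConnected G)
    (h : ∀ i j, G.Adj i j → j ∈ P.part i → j ∈ Q.part i) {i j : Fin n} (hij : j ∈ P.part i) :
    j ∈ Q.part i := by
  have huniv := fun i : Fin n => Finset.mem_univ i
  have hi : i ∈ P.part i := P.mem_part_self.2 (huniv i)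
  have hconn := hP _ (P.part_mem.2 (huniv i))
  have hreach := hconn.preconnected ⟨i, hi⟩ ⟨j, hij⟩
  have : ∀ a b : ((P.part i : Finset (Fin n)) : Set (Fin n)),
      (G.induce (P.part i : Set (Fin n))).Reachable a b → b.1 ∈ Q.part a.1 := by
    rintro a b ⟨w⟩
    induction w with
    | nil => exact Q.mem_part_self.2 (huniv _)
    | @cons a b c hab _ ih =>
      have h₁ : b.1 ∈ P.part a.1 := by
        rw [P.part_eq_of_mem (P.part_mem.2 (huniv i)) a.2]
        exact b.2
      have h₂ := h a.1 b.1 hab h₁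
      rw [Q.mem_part_iff_part_eq_part (huniv _) (huniv _)] at h₂ ih ⊢
      rw [ih, h₂]
  exact this _ _ hreach

/-- Each structure is mapped to the set of edges inside its coalitions. Two connected structures
with the same image refine each other along these edges, so the map is injective on them. -/
theorem ncard_connected_le {n : ℕ} (G : SimpleGraph (Fin n)) :
    ({P : CoalitionStructure n | P.IsConnected G} : Set (CoalitionStructure n)).ncard ≤
      2 ^ G.edgeSet.ncard := by
  classical
  rw [← Set.ncard_powerset]
  have huniv := fun i : Fin n => Finset.mem_univ i
  refine Set.ncard_le_ncard_of_injOn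
    (fun P => {e ∈ G.edgeSet | ∃ C ∈ P.parts, ∀ i ∈ e, i ∈ C}) (fun P _ => ?_) ?_ (Set.toFinite _)
  · exact fun e he => he.1
  · intro P hP Q hQ hPQ
    have key : ∀ i j, G.Adj i j → (j ∈ P.part i ↔ j ∈ Q.part i) := by
      intro i j hij
      have hR : ∀ R : CoalitionStructure n, j ∈ R.part i ↔
          s(i, j) ∈ {e ∈ G.edgeSet | ∃ C ∈ R.parts, ∀ i ∈ e, i ∈ C} := by
        intro R
        simp only [Set.mem_ofPred_eq, SimpleGraph.mem_edgeSet, hij, true_and, Sym2.mem_iff,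
          forall_eq_or_imp, forall_eq]
        rw [R.mem_part_iff_exists]
        constructor
        · rintro ⟨C, hC, h₁, h₂⟩
          exact ⟨C, hC, h₂, h₁⟩
        · rintro ⟨C, hC, h₁, h₂⟩
          exact ⟨C, hC, h₂, h₁⟩
      rw [hR P, hR Q]
      exact Set.ext_iff.1 hPQ _
    have hpart : ∀ i, P.part i = Q.part i := fun i => Finset.ext fun j =>
      ⟨fun h => hP.mem_part (fun i j hij => (key i j hij).1) h,
        fun h => hQ.mem_part (fun i j hij => (key i j hij).2) h⟩
    have himage : ∀ R : CoalitionStructure n, ∀ C, C ∈ R.parts ↔ ∃ i, R.part i = C := by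
      intro R C
      constructor
      · intro hC
        obtain ⟨i, hi⟩ := R.nonempty_of_mem_parts hC
        exact ⟨i, R.part_eq_of_mem hC hi⟩
      · rintro ⟨i, rfl⟩
        exact R.part_mem.2 (huniv i)
    refine Finpartition.ext (Finset.ext fun C => ?_)
    rw [himage, himage]
    simp only [hpart]

/-! ### Separators of induced subgraphs -/

theorem ncard_setOf_eq_length_filter {m : ℕ} (p : Fin m → Prop) [DecidablePred p] :
    {i | p i}.ncard = ((List.finRange m).filter fun i => p i).length := by
  rw [← List.toFinset_card_of_nodup ((List.nodup_finRange m).filter _), ← Set.ncard_coe_finset]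
  congr 1
  ext i
  simp

theorem GraphClass.SubgraphClosed.comap_mem {S : GraphClass} (hS : S.SubgraphClosed) {m n : ℕ}
    {G : SimpleGraph (Fin n)} (hG : G ∈ S n) {w : Fin m → Fin n} (hw : Function.Injective w) :
    G.comap w ∈ S m :=
  hS m n _ G hG ⟨⟨⟨w, fun h => h⟩, hw⟩⟩

/-- The induced subgraphs belong to the class and have at most `n` vertices, so monotonicity allows
the bound `f n` at every level of the recursion. -/
theorem GraphClass.FindsSeparators.separatesInduced {S : GraphClass} (hS : S.SubgraphClosed)
    {f : ℕ → ℝ} (hf : Monotone f) {α β : ℝ} (hαβ : α ≤ β) {q : Prog} {s : ℕ → ℝ}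
    (hq : S.FindsSeparators f α q s) {n : ℕ} {G : SimpleGraph (Fin n)} (hG : G ∈ S n) {t : ℕ}
    (ht : ∀ m, 1 ≤ m → m ≤ n → ∀ k : ℕ, (k : ℝ) ≤ s m → k ≤ t) :
    SeparatesInduced G q β ⌊f n⌋₊ t := by
  intro W hW hne
  obtain ⟨a, b, k, hrun, hk, A, B, ⟨hAB, hX, hA, hB⟩, hAa, hBb⟩ :=
    hq _ _ (hS.comap_mem hG hW.injective_get)
  have hm1 : 1 ≤ W.length := List.length_pos_iff.2 hne
  have hmn : W.length ≤ n := by simpa using hW.length_le_card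
  have hverts : A.verts ∪ B.verts = Set.univ := by
    rw [← SimpleGraph.Subgraph.verts_sup, hAB, SimpleGraph.Subgraph.verts_top]
  have hfrac : α * (W.length : ℝ) ≤ β * W.length :=
    mul_le_mul_of_nonneg_right hαβ (Nat.cast_nonneg _)
  refine ⟨a, b, k, ht _ hm1 hmn k hk, hrun, fun j => ?_, Nat.le_floor ?_, ?_, ?_, ?_⟩
  · have : j ∈ A.verts ∪ B.verts := hverts ▸ Set.mem_univ j
    rwa [hAa, hBb] at this
  · rw [← ncard_setOf_eq_length_filter]
    rw [hAa, hBb] at hX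
    exact hX.trans (hf hmn)
  · rw [← ncard_setOf_eq_length_filter]
    rw [hAa, hBb] at hA
    exact hA.trans hfrac
  · rw [← ncard_setOf_eq_length_filter]
    rw [hAa, hBb] at hB
    exact hB.trans hfrac
  · intro i j _ hib _ hja hadj
    -- An edge belongs to `A` or to `B`, which then contains both of its ends; hence no edge joins
    -- the two sides.
    have : (A ⊔ B).Adj i j := by rw [hAB]; exact hadj
    rcases SimpleGraph.Subgraph.sup_adj.1 this with h | h
    · exact hja (by have := A.edge_vert h.symm; rwa [hAa] at this)
    · exact hib (by have := B.edge_vert h; rwa [hBb] at this)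

/-- The class contains the graph with one vertex. As `α < 1`, both differences of a separation of it
are empty, so the vertex lies in the intersection. -/
theorem GraphClass.SeparatorTheorem.one_le {S : GraphClass} (hS : S.SubgraphClosed) {f : ℕ → ℝ}
    (hf : Monotone f) {α : ℝ} (hα : α < 1) (hsep : S.SeparatorTheorem f α) {n : ℕ}
    {G : SimpleGraph (Fin n)} (hG : G ∈ S n) (hn : 1 ≤ n) {m : ℕ} (hm : 1 ≤ m) : 1 ≤ f m := by
  refine le_trans ?_ (hf hm)
  have hmem : G.comap (fun _ : Fin 1 => (⟨0, hn⟩ : Fin n)) ∈ S 1 :=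
    hS.comap_mem hG (Function.injective_of_subsingleton _)
  obtain ⟨A, B, hAB, hX, hA, hB⟩ := hsep 1 _ hmem
  have hverts : A.verts ∪ B.verts = Set.univ := by
    rw [← SimpleGraph.Subgraph.verts_sup, hAB, SimpleGraph.Subgraph.verts_top]
  have hzero : ∀ s : Set (Fin 1), (s.ncard : ℝ) ≤ α * (1 : ℕ) → s = ∅ := by
    intro s hs
    have : (s.ncard : ℝ) < 1 := by push_cast at hs; linarith
    exact (Set.ncard_eq_zero s.toFinite).1 (by exact_mod_cast Nat.lt_one_iff.1 (by exact_mod_cast this))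
  have hA := Set.sdiff_eq_empty.1 (hzero _ hA)
  have hB := Set.sdiff_eq_empty.1 (hzero _ hB)
  have hAB' := hA.antisymm hB
  rw [hAB', Set.union_self] at hverts
  rw [hAB', Set.inter_self, hverts] at hX
  simpa [Set.ncard_univ] using hX

theorem separatorSteps_mono {f : ℕ → ℝ} (hf : Monotone f) {μ : ℝ → ℝ}
    (hμ : MonotoneOn μ (Set.Ici (0 : ℝ))) {m n : ℕ} (hm : 1 ≤ f m) (hmn : m ≤ n) :
    (2 : ℝ) ^ (2 * μ (f m)) * f m ^ (2 * f m) ≤ (2 : ℝ) ^ (2 * μ (f n)) * f n ^ (2 * f n) := by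
  have hfmn := hf hmn
  have h₁ : μ (f m) ≤ μ (f n) := hμ (Set.mem_Ici.2 (by linarith)) (Set.mem_Ici.2 (by linarith)) hfmn
  refine mul_le_mul (Real.rpow_le_rpow_of_exponent_le (by norm_num) (by linarith)) ?_
    (by positivity) (by positivity)
  exact (Real.rpow_le_rpow (by linarith) hfmn (by linarith)).trans
    (Real.rpow_le_rpow_of_exponent_le (by linarith) (by linarith))

/-- Bounds that hold asymptotically hold everywhere, up to a constant. -/
theorem exists_forall_le_mul_of_isBigO {s g : ℕ → ℝ} (h : s =O[atTop] g)
    (hg : ∀ n, 1 ≤ n → 1 ≤ g n) : ∃ K : ℝ, 0 ≤ K ∧ ∀ n, 1 ≤ n → s n ≤ K * g n := by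
  obtain ⟨C, hC, h⟩ := h.exists_nonneg
  obtain ⟨N, hN⟩ := eventually_atTop.1 h.bound
  have hsum : ∀ m ∈ Finset.range N, |s m| ≤ ∑ i ∈ Finset.range N, |s i| := fun m hm =>
    Finset.single_le_sum (f := fun i => |s i|) (fun i _ => abs_nonneg _) hm
  have hK0 : 0 ≤ ∑ i ∈ Finset.range N, |s i| := Finset.sum_nonneg fun i _ => abs_nonneg _
  -- The finitely many values before the asymptotic range are absorbed by their sum, because `g` is
  -- at least `1`.
  refine ⟨C + ∑ i ∈ Finset.range N, |s i|, by positivity, fun n hn => ?_⟩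
  have hgn := hg n hn
  rw [add_mul]
  rcases le_or_gt N n with hNn | hNn
  · have := hN n hNn
    rw [Real.norm_of_nonneg (show 0 ≤ g n by linarith)] at this
    exact ((le_abs_self _).trans this).trans (le_add_of_nonneg_right (by positivity))
  · have h₁ := hsum n (Finset.mem_range.2 hNn)
    have h₂ : (∑ i ∈ Finset.range N, |s i|) ≤ (∑ i ∈ Finset.range N, |s i|) * g n :=
      le_mul_of_one_le_right hK0 hgn
    have h₃ : 0 ≤ C * g n := by positivity
    linarith [le_abs_self (s n)]

/-- Taking logarithms, the claim is `log n < D * |log β|`; the `+ 1` after the floor makes it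
strict. -/
theorem pow_floor_mul_lt_one {β : ℝ} (hβ₀ : 0 < β) (hβ₁ : β < 1) {n : ℕ} (hn : 1 ≤ n) :
    β ^ (⌊1 / |Real.log β| * Real.log n⌋₊ + 1) * n < 1 := by
  have hn0 : (0 : ℝ) < n := by exact_mod_cast hn
  have hlog : Real.log β < 0 := Real.log_neg hβ₀ hβ₁
  have h := Nat.lt_floor_add_one (1 / |Real.log β| * Real.log n)
  set D := ⌊1 / |Real.log β| * Real.log n⌋₊ + 1 with hD
  have hDR : 1 / |Real.log β| * Real.log n < D := by rw [hD]; push_cast; exact h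
  rw [abs_of_neg hlog, one_div, inv_mul_lt_iff₀ (by linarith)] at hDR
  rw [← Real.log_neg_iff (by positivity), Real.log_mul (by positivity) (by positivity),
    Real.log_pow]
  linarith

/-! ### The main theorem. -/

theorem corollary2
    (S : GraphClass) (hS : S.SubgraphClosed)
    (μ : ℝ → ℝ) (hμ_mono : MonotoneOn μ (Set.Ici (0 : ℝ))) (hμ_le : ∀ n : ℕ, μ n ≤ (n : ℝ) ^ 2 / 2)
    (hμ_edges : ∀ (n : ℕ), ∀ G ∈ S n, (G.edgeSet.ncard : ℝ) ≤ μ n)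
    (f : ℕ → ℝ) (hf_mono : Monotone f) (hf_o : f =o[atTop] fun n : ℕ => (n : ℝ))
    (α : ℝ) (hα : α < 1) (hsep : S.SeparatorTheorem f α)
    (hfind : ∃ (q : Prog) (s : ℕ → ℝ),
      (s =o[atTop] fun n : ℕ => (2 : ℝ) ^ (2 * μ (f n)) * f n ^ (2 * f n)) ∧
      S.FindsSeparators f α q s) :
    (∀ (n : ℕ), ∀ G ∈ S n,
      (({P : CoalitionStructure n | P.IsConnected G} : Set (CoalitionStructure n)).ncard : ℝ)
        ≤ (2 : ℝ) ^ μ n) ∧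
    ∀ β : ℝ, 0 < β → α < β → β < 1 → ∀ c : ℝ, c = 1 / |Real.log β| →
      ∃ (p : Prog) (T : ℕ → ℝ),
        (T =O[atTop] fun n : ℕ => (n : ℝ) ^
          (2 * Real.log 2 * c * μ (f n) + 2 * c * f n * Real.log (c * Real.log n * f n))) ∧
        S.SolvesGCSG p T := by
  refine ⟨fun n G hG => ?_, fun β hβ₀ hαβ hβ₁ c hc => ?_⟩
  · calc (({P : CoalitionStructure n | P.IsConnected G} : Set _).ncard : ℝ)
        ≤ ((2 ^ G.edgeSet.ncard : ℕ) : ℝ) := by exact_mod_cast ncard_connected_le G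
      _ = (2 : ℝ) ^ (G.edgeSet.ncard : ℝ) := by rw [Real.rpow_natCast]; push_cast; rfl
      _ ≤ (2 : ℝ) ^ μ n := Real.rpow_le_rpow_of_exponent_le (by norm_num) (hμ_edges n G hG)
  -- Connected graphs are nonempty, so without nonempty members of the class any program works.
  -- Otherwise a nonempty member yields `1 ≤ f n`.
  by_cases htriv : ∀ n, 1 ≤ n → S n = ∅
  · refine ⟨.lit 0, fun _ => 0, isBigO_zero _ _, fun n G hG hconn => ?_⟩
    have hn : 1 ≤ n := by
      obtain ⟨i⟩ := hconn.nonempty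
      exact Fin.pos i
    rw [htriv n hn] at hG
    exact hG.elim
  push Not at htriv
  obtain ⟨n₀, hn₀, G₀, hG₀⟩ := htriv
  have hf1 : ∀ n, 1 ≤ n → 1 ≤ f n := fun n hn => hsep.one_le hS hf_mono hα hG₀ hn₀ hn
  have hμ0 : ∀ n, 1 ≤ n → 0 ≤ μ (f n) := fun n hn => by
    -- The graph without vertices is in the class and forces `0 ≤ μ 0`; monotonicity then gives `0 ≤
    -- μ (f n)`.
    have h₀ := hμ_edges 0 _ (hS.comap_mem hG₀ (w := Fin.elim0) (Function.injective_of_subsingleton _))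
    refine ((Nat.cast_nonneg _).trans h₀).trans ?_
    have := hf1 n hn
    exact hμ_mono (by simp) (Set.mem_Ici.2 (by linarith)) (by simp; linarith)
  obtain ⟨q, s, hs, hq⟩ := hfind
  -- The recursion meets graphs of every size up to `n`, so the separator bound is needed for all
  -- sizes, with a uniform constant.
  obtain ⟨K, hK, hsK⟩ := exists_forall_le_mul_of_isBigO hs.isBigO fun n hn =>
    one_le_mul_of_one_le_of_one_le
      (Real.one_le_rpow (by norm_num) (by linarith [hμ0 n hn]))
      (Real.one_le_rpow (hf1 n hn) (by linarith [hf1 n hn]))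
  have hc0 : 0 < c := by
    rw [hc]
    exact one_div_pos.2 (abs_pos.2 (Real.log_neg hβ₀ hβ₁).ne)
  refine ⟨.solve q, _, isBigO_steps hf1 hμ0 hc0 hK, fun n G hG hconn v h₀ hv => ?_⟩
  have hn : 1 ≤ n := by
    obtain ⟨i⟩ := hconn.nonempty
    exact Fin.pos i
  have hsepI := hq.separatesInduced hS hf_mono hαβ.le hG
    (t := ⌊K * ((2 : ℝ) ^ (2 * μ (f n)) * f n ^ (2 * f n))⌋₊) fun m hm hmn k hk =>
      Nat.le_floor ((hk.trans (hsK m hm)).trans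
        (mul_le_mul_of_nonneg_left (separatorSteps_mono hf_mono hμ_mono (hf1 m hm) hmn) hK))
  obtain ⟨y, t, P, hrun, ht, hP, hmax⟩ := exists_runs_solve hv h₀ hβ₀.le
    (Nat.le_floor (by simpa using hf1 n hn)) hsepI (D := ⌊c * Real.log n⌋₊ + 1) (by omega)
    (by rw [hc]; exact pow_floor_mul_lt_one hβ₀ hβ₁ hn)
  exact ⟨y, t, P, hrun, by exact_mod_cast ht, hP, hmax⟩
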